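/- For $\epsilon>0$ let $T_\epsilon(x,y)=(x+y+\epsilon\sin x,\;y+\epsilon\sin x)$ be the standard map of the cylinder $\mathbb{R}/2\pi\mathbb{Z}\times\mathbb{R}$. Its rotation number at $(x,y)$ is defined by $2\pi\,\omega_T(x,y,\epsilon)=\lim_{n\to\infty}\frac{\pi_1(T_\epsilon^n(x,y))-x}{n}$, where $\pi_1$ is the first coordinate and the iterates are taken on the universal cover $\mathbb{R}^2$, when the limit exists. An invariant circle of $T_\epsilon$ is a homotopically non-trivial regular simple closed $C^1$ curve $\Gamma$ in the cylinder with $T_\epsilon(\Gamma)=\Gamma$. Let $H_p(x,z)=\frac{z^2}{2}+\cos x$ be the pendulum Hamiltonian. An orbit $(X(t),Z(t))$ of $H_p$ (i.e. $\dot X=Z$, $\dot Z=\sin X$) with $X$ lifted to $\mathbb{R}$ has frequency $\omega_{pend}$ if $2\pi\,\omega_{pend}=\lim_{t\to+\infty}\frac{X(t)-X(0)}{t}$; for a rotation orbit, whose energy is greater than $1$, $|\omega_{pend}|$ is the reciprocal of its period. Let $h_0>1$ and $K\in\mathbb{R}$. There are constants $C>0$ and $\epsilon_0>0$, depending only on $h_0$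 and $K$, such that the following holds for all $0<\epsilon<\epsilon_0$. Let $(x_0,y_0)$ be a point of an invariant circle of $T_\epsilon$, put $z_0=y_0/\sqrt\epsilon$, and suppose that the circle has energy $h_0$ at this point up to terms of order $\epsilon$: $$\Big|\frac{z_0^2}{2}+\cos x_0+\frac{\sqrt\epsilon}{2}\,z_0\sin x_0-h_0\Big|\le K\epsilon .$$ (If $\sin x_0=0$, in particular on the $y$-axis, the left side is $|H_p(x_0,z_0)-h_0|$.) Let $(X,Z)$ be any orbit of the pendulum of energy $h_0$ that turns in the same direction, i.e. $Z(0)\,y_0>0$. Then the rotation number $\omega_T(x_0,y_0,\epsilon)$ and the frequency $\omega_{pend}$ of $(X,Z)$ exist, and $$\big|\omega_T(x_0,y_0,\epsilon)-\sqrt{\epsilon}\,\omega_{pend}\big|\le C\,\epsilon^{3/2}.$$ In particular, if $\sin x_0=0$ and $H_p(x_0,z_0)=h_0$, one may take the orbit of the pendulum through $(x_0,z_0)$ itself. -/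

import Mathlib

open Filter Topology

/-- The cylinder `ℝ / 2πℤ × ℝ`. -/
abbrev Cylinder : Type := Real.Angle × ℝ

/-- The standard map `T_ε (x, y) = (x + y + ε sin x, y + ε sin x)` of the cylinder. -/
noncomputable def standardMap (ε : ℝ) (p : Cylinder) : Cylinder :=
  (p.1 + ((p.2 + ε * p.1.sin : ℝ) : Real.Angle), p.2 + ε * p.1.sin)

/-- The covering projection of the plane onto the cylinder. -/
noncomputable def toCylinder (p : ℝ × ℝ) : Cylinder := ((p.1 : Real.Angle), p.2)

/-- The standard map on the universal cover `ℝ × ℝ` of the cylinder. -/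
noncomputable def standardMapLift (ε : ℝ) (p : ℝ × ℝ) : ℝ × ℝ :=
  (p.1 + p.2 + ε * Real.sin p.1, p.2 + ε * Real.sin p.1)

theorem toCylinder_standardMapLift (ε : ℝ) (p : ℝ × ℝ) :
    toCylinder (standardMapLift ε p) = standardMap ε (toCylinder p) := by
  simp [toCylinder, standardMapLift, standardMap, add_assoc]

/-- The rotation number of the standard map at `(x, y)` exists and equals `ω`:
`2πω = lim (π₁ (T_ε^n (x, y)) - x) / n`, the iterates being taken on the universal cover. -/
def HasRotationNumber (ε x y ω : ℝ) : Prop :=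
  Tendsto (fun n : ℕ => (((standardMapLift ε)^[n] (x, y)).1 - x) / n) atTop
    (𝓝 (2 * Real.pi * ω))

/-- `Γ` is a `C¹` homotopically non-trivial circle in the cylinder: the trace of a `C¹` regular
simple closed curve (parametrized on `ℝ / ℤ`, and given here by a lift `γ` to the universal cover)
whose winding number `k` around the cylinder is not zero. -/
def IsEssentialCircle (Γ : Set Cylinder) : Prop :=
  ∃ γ : ℝ → ℝ × ℝ,
    ContDiff ℝ 1 γ ∧ (∀ s, deriv γ s ≠ 0) ∧
    (∃ k : ℤ, k ≠ 0 ∧ ∀ s, γ (s + 1) = γ s + (2 * Real.pi * k, 0)) ∧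
    (∀ s t, toCylinder (γ s) = toCylinder (γ t) → ∃ m : ℤ, t = s + m) ∧
    Γ = Set.range (fun s => toCylinder (γ s))

/-- `Γ` is a `C¹` homotopically non-trivial invariant circle of the standard map. -/
def IsInvariantCircle (ε : ℝ) (Γ : Set Cylinder) : Prop :=
  IsEssentialCircle Γ ∧ standardMap ε '' Γ = Γ

/-- The pendulum Hamiltonian `H_p (x, z) = z² / 2 + cos x`. -/
noncomputable def pendulumEnergy (x z : ℝ) : ℝ := z ^ 2 / 2 + Real.cos x

/-- `(X, Z)` is an orbit (defined for all times, with `X` lifted to `ℝ`) of the Hamiltonian system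
of `H_p`: `X' = ∂H_p/∂z = Z`, `Z' = -∂H_p/∂x = sin X`. -/
def IsPendulumOrbit (X Z : ℝ → ℝ) : Prop :=
  ∀ t, HasDerivAt X (Z t) t ∧ HasDerivAt Z (Real.sin (X t)) t

/-- The orbit with angle `X` has frequency `ω`: `2πω = lim (X t - X 0) / t`. -/
def HasFrequency (X : ℝ → ℝ) (ω : ℝ) : Prop :=
  Tendsto (fun t : ℝ => (X t - X 0) / t) atTop (𝓝 (2 * Real.pi * ω))

/-- The energy of the standard map in the coordinates `(x, z)`, `y = μ z`, `μ = √ε`: the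
Hamiltonian `H (x, z, μ) = z² / 2 + cos x + (μ / 2) z sin x + O(μ²)` whose flow interpolates the
standard map, up to its terms of order `μ²`. It equals `H_p (x, z)` when `sin x = 0`. -/
noncomputable def interpolatingEnergy (μ x z : ℝ) : ℝ :=
  pendulumEnergy x z + μ * (z / 2 * Real.sin x)

/-! Put μ = √ε. Suppose that, for some number N of iterates with 1 ≤ N μ³ ≤ 2, the lifted angle
stays within a bounded distance both of the uniform rotation with slope 2π ω_T and of the one with
slope 2π μ ω_pend. Then the slopes differ by O(1/N) = O(μ³) = O(ε^{3/2}); this is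
`abs_sub_le_of_slopes`. Two bounded-deviation estimates are needed.

The first is topological and holds for all times. By Birkhoff's theorem
(`IsInvariantCircle.exists_graph`) the circle is a graph over the angle, so the map induces on it an
increasing lift of degree one, whose orbits deviate from the uniform rotation by at most one turn.
To prove Birkhoff's theorem, look at the lifted curve from a point p below it: the direction of the
curve has a continuous angle running from π to 0. The standard map is a vertical shear followed by a
horizontal one, and it sends an angle at most equal to a downward vertical to an angle strictly
smaller (`IsAngleLift.twist`). Hence the points that see some angle ≤ -π/2 are mapped into an open
set of such points. Area on the cylinder is preserved and the area involved is finite, so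
connectedness of the region below the curve leaves no such point; the same argument for the inverse
excludes angles ≥ 3π/2. So no point of the curve lies directly beneath p, and mapping vertical
segments forwards and backwards yields cones, hence a Lipschitz graph.

The second is analytic. In the variable w = z + (μ/2) sin x the standard map is the Verlet scheme of
step μ for the pendulum. A modified energy, evaluated at midpoints of links, changes by O(μ⁵) per
step and differs from the pendulum energy by O(μ²), so over O(μ⁻³) steps the energy stays
O(μ²)-close to h₀ (`exists_energy_le`). Each step then advances the time coordinate of the pendulum
by μ + O(μ³) (`exists_pendulumTime_step`). The accumulated time error is bounded, and time is linear
in the angle up to a bounded periodic term. -/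

/-! ### Normalized angles of planar paths and their behaviour under shears -/

/-- `θ` is a continuous determination of the angle of the nowhere vanishing planar path `v`,
normalized to tend to `0` at `+∞` and to `π` at `-∞`. -/
structure IsAngleLift (v : ℝ → ℂ) (θ : ℝ → ℝ) : Prop where
  cont : Continuous θ
  eq : ∀ s, v s = ‖v s‖ * Complex.exp (θ s * Complex.I)
  top : Tendsto θ atTop (𝓝 0)
  bot : Tendsto θ atBot (𝓝 Real.pi)

namespace IsAngleLift

variable {v v' : ℝ → ℂ} {θ θ' : ℝ → ℝ}

theorem re_eq (h : IsAngleLift v θ) (s : ℝ) : (v s).re = ‖v s‖ * Real.cos (θ s) := by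
  conv_lhs => rw [h.eq s]
  rw [Complex.re_ofReal_mul, Complex.exp_ofReal_mul_I_re]

theorem im_eq (h : IsAngleLift v θ) (s : ℝ) : (v s).im = ‖v s‖ * Real.sin (θ s) := by
  conv_lhs => rw [h.eq s]
  rw [Complex.im_ofReal_mul, Complex.exp_ofReal_mul_I_im]

/-- A lift of a path is changed into a lift of a path that is nowhere opposite to it. -/
theorem perturb (h : IsAngleLift v θ) (hv : Continuous v) (hv' : Continuous v')
    (h0 : ∀ s, v s ≠ 0) (hs : ∀ s, v' s / v s ∈ Complex.slitPlane)
    (ht : Tendsto (fun s => v' s / v s) atTop (𝓝 1))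
    (hb : Tendsto (fun s => v' s / v s) atBot (𝓝 1)) :
    IsAngleLift v' (fun s => θ s + (v' s / v s).arg) := by
  have harg : Tendsto Complex.arg (𝓝 1) (𝓝 0) := by
    have := (Complex.continuousAt_arg (x := 1) (by simp)).tendsto
    rwa [Complex.arg_one] at this
  refine ⟨?_, fun s => ?_, ?_, ?_⟩
  · refine h.cont.add (continuous_iff_continuousAt.2 fun s => ?_)
    exact (Complex.continuousAt_arg (hs s)).comp (f := fun s => v' s / v s)
      ((hv'.div hv h0).continuousAt)
  · have e1 : v' s = v s * (v' s / v s) := by field_simp [h0 s]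
    have e2 := Complex.norm_mul_exp_arg_mul_I (v' s / v s)
    have e3 : ‖v' s‖ = ‖v s‖ * ‖v' s / v s‖ := by rw [← norm_mul, ← e1]
    set q := v' s / v s
    rw [e3, e1]
    push_cast
    rw [add_mul, Complex.exp_add]
    linear_combination (‖q‖ * Complex.exp (q.arg * Complex.I)) * h.eq s - v s * e2
  · simpa using h.top.add (harg.comp ht)
  · simpa using h.bot.add (harg.comp hb)

/-- A normalized lift is unique. -/
theorem unique (h : IsAngleLift v θ) (h' : IsAngleLift v θ') (h0 : ∀ s, v s ≠ 0) : θ = θ' := by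
  have key : ∀ s, ∃ n : ℤ, θ s = θ' s + n * (2 * Real.pi) := by
    intro s
    have e := (h.eq s).symm.trans (h'.eq s)
    have := mul_left_cancel₀ (by simpa using h0 s) e
    obtain ⟨n, hn⟩ := Complex.exp_eq_exp_iff_exists_int.1 this
    refine ⟨n, ?_⟩
    have := congrArg Complex.im hn
    simpa using this
  have hc : Continuous fun s => (θ s - θ' s) / (2 * Real.pi) :=
    (h.cont.sub h'.cont).div_const _
  choose n hn using key
  have e : ∀ s, (θ s - θ' s) / (2 * Real.pi) = n s := fun s => by
    rw [hn s]; field_simp [Real.pi_ne_zero]; ring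
  -- A continuous integer-valued function on the line is constant, and the common limit at `+∞`
  -- makes it zero.
  have hnc : Continuous n := by
    rw [Int.isClosedEmbedding_coe_real.isInducing.continuous_iff]
    exact hc.congr e
  obtain ⟨N, hN⟩ : ∃ N, ∀ s, n s = N :=
    ⟨n 0, fun s => PreconnectedSpace.constant inferInstance hnc⟩
  have hl : Tendsto (fun s => (θ s - θ' s) / (2 * Real.pi)) atTop (𝓝 0) := by
    simpa using (h.top.sub h'.top).div_const (2 * Real.pi)
  have : (N : ℝ) = 0 := by
    refine tendsto_nhds_unique ?_ hl
    simp only [e, hN]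
    exact tendsto_const_nhds
  funext s
  have := hn s
  rw [hN s] at this
  simp_all

theorem comp (h : IsAngleLift v θ) {f : ℝ → ℝ} (hf : Continuous f) (ht : Tendsto f atTop atTop)
    (hb : Tendsto f atBot atBot) : IsAngleLift (v ∘ f) (θ ∘ f) :=
  ⟨h.cont.comp hf, fun s => h.eq (f s), h.top.comp ht, h.bot.comp hb⟩

end IsAngleLift

/-- A path in the upper half plane that goes to infinity horizontally from left to right. -/
theorem isAngleLift_arg {v : ℝ → ℂ} {L : ℝ} (hL : 0 < L) (hv : Continuous v)
    (him : ∀ s, 0 < (v s).im)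
    (ht : Tendsto (fun s : ℝ => v s / (L * s : ℝ)) atTop (𝓝 1))
    (hb : Tendsto (fun s : ℝ => v s / (L * s : ℝ)) atBot (𝓝 1)) : IsAngleLift v (fun s => (v s).arg) := by
  have harg : Tendsto Complex.arg (𝓝 1) (𝓝 0) := by
    have := (Complex.continuousAt_arg (x := 1) (by simp)).tendsto
    rwa [Complex.arg_one] at this
  refine ⟨continuous_iff_continuousAt.2 fun s => ?_, fun s => ?_, ?_, ?_⟩
  · exact (Complex.continuousAt_arg (Or.inr (him s).ne')).comp (f := v) hv.continuousAt
  · exact (Complex.norm_mul_exp_arg_mul_I _).symm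
  · refine (harg.comp ht).congr' ?_
    filter_upwards [eventually_gt_atTop 0] with s hs
    have : v s / (L * s : ℝ) = (((L * s)⁻¹ : ℝ) : ℂ) * v s := by push_cast; ring
    simp only [Function.comp]
    rw [this, Complex.arg_real_mul _ (inv_pos.2 (mul_pos hL hs))]
  · have : Tendsto (fun s : ℝ => Real.pi + (v s / (L * s : ℝ)).arg) atBot (𝓝 Real.pi) := by
      simpa using tendsto_const_nhds.add (harg.comp hb)
    refine this.congr' ?_
    filter_upwards [eventually_lt_atBot 0] with s hs
    have : v s / (L * s : ℝ) = (((-(L * s))⁻¹ : ℝ) : ℂ) * (-v s) := by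
      push_cast
      rw [inv_neg]; ring
    rw [this, Complex.arg_real_mul _ (inv_pos.2 (neg_pos.2 (mul_neg_of_pos_of_neg hL hs))),
      Complex.arg_neg_eq_arg_sub_pi_of_im_pos (him s)]
    ring

theorem cos_add_of_sin_eq_neg_one {a t : ℝ} (ha : Real.sin a = -1) :
    Real.cos (a + t) = Real.sin t := by
  have : Real.cos a = 0 := by
    have := Real.sin_sq_add_cos_sq a
    rw [ha] at this
    nlinarith
  rw [Real.cos_add, ha, this]; ring

/-- A vertical shear keeps angles on their side of the downward vertical. -/
theorem angle_le_of_verticalShear {q z : ℂ} {r t a : ℝ} (ha : Real.sin a = -1)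
    (hzt : z.re = r * Real.cos t) (hr : 0 < r) (hq : (z * q).re = z.re)
    (hq0 : z.re = 0 → q = 1) (hrt : (z * q).re = ‖z * q‖ * Real.cos (t + q.arg))
    (hs : q ∈ Complex.slitPlane) (h : t ≤ a) : t + q.arg ≤ a := by
  by_cases h0 : z.re = 0
  · simpa [hq0 h0] using h
  by_contra! hlt
  have hqn : 0 < ‖z * q‖ := by
    rw [norm_pos_iff]
    intro hh
    rw [hh] at hq
    exact h0 (by simpa using hq.symm)
  -- On the contrary assumption, `t - a` lies in (-π, 0] and `t + q.arg - a` in (0, π), so the real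
  -- parts before and after have different signs, whereas a vertical shear does not change the real
  -- part.
  have h1 := cos_add_of_sin_eq_neg_one (t := t - a) ha
  have h2 := cos_add_of_sin_eq_neg_one (t := t + q.arg - a) ha
  rw [add_sub_cancel] at h1 h2
  have hpi := Complex.arg_le_pi q
  have hne := Complex.slitPlane_arg_ne_pi hs
  have hlt' : q.arg < Real.pi := lt_of_le_of_ne hpi hne
  have s1 : Real.sin (t - a) ≤ 0 :=
    Real.sin_nonpos_of_nonpos_of_neg_pi_le (by linarith) (by linarith)
  have s2 : 0 < Real.sin (t + q.arg - a) :=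
    Real.sin_pos_of_pos_of_lt_pi (by linarith) (by linarith)
  rw [← h1] at s1
  rw [← h2] at s2
  have c1 : z.re ≤ 0 := by rw [hzt]; exact mul_nonpos_of_nonneg_of_nonpos hr.le s1
  have c2 : 0 < z.re := by rw [← hq, hrt]; exact mul_pos hqn s2
  linarith

/-- A bounded displacement of a path going to infinity is negligible in direction; this preserves
the normalization of angles at both ends. -/
theorem tendsto_add_div_self {ι : Type*} {l : Filter ι} {v d : ι → ℂ} {D : ℝ}
    (hv : Tendsto (fun s => ‖v s‖) l atTop) (hd : ∀ s, ‖d s‖ ≤ D) :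
    Tendsto (fun s => (v s + d s) / v s) l (𝓝 1) := by
  have h0 : Tendsto (fun s => d s / v s) l (𝓝 0) := by
    rw [tendsto_zero_iff_norm_tendsto_zero]
    refine squeeze_zero (fun s => norm_nonneg _) (fun s => ?_)
      ((tendsto_const_nhds (x := D)).div_atTop hv)
    rw [norm_div]
    gcongr
    exact hd s
  have h1 : Tendsto (fun s => 1 + d s / v s) l (𝓝 1) := by
    simpa using h0.const_add 1
  refine h1.congr' ?_
  filter_upwards [hv.eventually_gt_atTop 0] with s hs
  have : v s ≠ 0 := norm_pos_iff.1 hs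
  field_simp

/-- Effect on the angle of a vertical shear followed by a horizontal one. -/
theorem IsAngleLift.twist {v : ℝ → ℂ} {θ : ℝ → ℝ} (h : IsAngleLift v θ) (hv : Continuous v)
    (h0 : ∀ s, v s ≠ 0) {k : ℝ → ℝ} (hk : Continuous k) (hk0 : ∀ s, (v s).re = 0 → k s = 0)
    {D : ℝ} (hkD : ∀ s, |k s| ≤ D) (hvD : ∀ s, |(v s).im| ≤ D)
    (ht : Tendsto (fun s => ‖v s‖) atTop atTop) (hb : Tendsto (fun s => ‖v s‖) atBot atTop) :
    ∃ θ' : ℝ → ℝ,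
      IsAngleLift (fun s => v s + k s * Complex.I + ((v s).im + k s : ℝ)) θ' ∧
      ∀ a, Real.sin a = -1 → ∀ s, θ s ≤ a → θ' s < a := by
  set v₁ : ℝ → ℂ := fun s => v s + k s * Complex.I with hv₁
  have hre : ∀ s, (v₁ s).re = (v s).re := fun s => by simp [hv₁]
  have him : ∀ s, (v₁ s).im = (v s).im + k s := fun s => by simp [hv₁]
  have hc₁ : Continuous v₁ := by fun_prop
  have h01 : ∀ s, v₁ s ≠ 0 := by
    intro s hs
    have e1 : (v s).re = 0 := by rw [← hre s, hs]; rfl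
    have e2 : (v s).im = 0 := by
      have := him s
      rw [hs, hk0 s e1] at this
      simpa using this.symm
    exact h0 s (Complex.ext e1 e2)
  -- If the quotient were real and nonpositive, equality of the real parts would force them to
  -- vanish; but there `k` vanishes and the quotient is 1.
  have hs₁ : ∀ s, v₁ s / v s ∈ Complex.slitPlane := by
    intro s
    rw [Complex.mem_slitPlane_iff_not_le_zero]
    intro hle
    set q := v₁ s / v s with hq
    have hqv : v₁ s = q * v s := by rw [hq]; field_simp [h0 s]
    rw [Complex.le_def] at hle
    obtain ⟨hr, hi⟩ := hle
    simp only [Complex.zero_re, Complex.zero_im] at hr hi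
    have e := congrArg Complex.re hqv
    rw [hre, Complex.mul_re, hi] at e
    have e1 : (v s).re = 0 := by
      have : (v s).re * (1 - q.re) = 0 := by linarith
      rcases mul_eq_zero.1 this with h | h
      · exact h
      · linarith
    have : q = 1 := by
      rw [hq, div_eq_one_iff_eq (h0 s)]
      simp [hv₁, hk0 s e1]
    rw [this] at hr
    norm_num at hr
  have hn₁ : ∀ s, ‖v s‖ - D ≤ ‖v₁ s‖ := fun s => by
    have h1 : ‖v s‖ ≤ ‖v₁ s‖ + ‖(k s : ℂ) * Complex.I‖ := by
      have := norm_sub_le (v₁ s) (k s * Complex.I)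
      simpa [hv₁] using this
    have h2 : ‖(k s : ℂ) * Complex.I‖ ≤ D := by simpa using hkD s
    linarith
  have hd₁ : ∀ s, ‖(k s : ℂ) * Complex.I‖ ≤ D := fun s => by simpa using hkD s
  have L₁ := h.perturb hv hc₁ h0 hs₁ (tendsto_add_div_self ht hd₁) (tendsto_add_div_self hb hd₁)
  have ht₁ : Tendsto (fun s => ‖v₁ s‖) atTop atTop :=
    tendsto_atTop_mono hn₁ (tendsto_atTop_add_const_right _ (-D) ht)
  have hb₁ : Tendsto (fun s => ‖v₁ s‖) atBot atTop :=
    tendsto_atTop_mono hn₁ (tendsto_atTop_add_const_right _ (-D) hb)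
  have hd₂ : ∀ s, ‖(((v s).im + k s : ℝ) : ℂ)‖ ≤ D + D := fun s => by
    rw [Complex.norm_real]
    exact (abs_add_le _ _).trans (add_le_add (hvD s) (hkD s))
  -- The horizontal shear multiplies `v₁` by a number of imaginary part `-(im v₁)² / |v₁|²`, so it
  -- turns clockwise, strictly unless `v₁` is horizontal.
  have hratio : ∀ s, (v₁ s + ((v s).im + k s : ℝ)) / v₁ s = 1 + ((v₁ s).im : ℂ) / v₁ s := by
    intro s
    rw [add_div, div_self (h01 s), him]
  have himr : ∀ s, (1 + ((v₁ s).im : ℂ) / v₁ s).im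
      = - ((v₁ s).im ^ 2 / Complex.normSq (v₁ s)) := by
    intro s
    simp [Complex.div_im]
    ring
  have hs₂ : ∀ s, (v₁ s + ((v s).im + k s : ℝ)) / v₁ s ∈ Complex.slitPlane := by
    intro s
    rw [hratio]
    by_cases hw : (v₁ s).im = 0
    · simp [hw]
    · refine Or.inr ?_
      rw [himr]
      have := Complex.normSq_pos.2 (h01 s)
      have : 0 < (v₁ s).im ^ 2 := by positivity
      exact (neg_neg_of_pos (by positivity)).ne
  have L₂ := L₁.perturb hc₁ (v' := fun s => v₁ s + ((v s).im + k s : ℝ))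
    (by fun_prop) h01 hs₂ (tendsto_add_div_self ht₁ hd₂)
    (tendsto_add_div_self hb₁ hd₂)
  refine ⟨_, L₂, fun a ha s hle => ?_⟩
  have hqv : v s * (v₁ s / v s) = v₁ s := mul_div_cancel₀ _ (h0 s)
  have step₁ : θ s + (v₁ s / v s).arg ≤ a := by
    refine angle_le_of_verticalShear ha (h.re_eq s) (norm_pos_iff.2 (h0 s)) ?_ ?_ ?_ (hs₁ s) hle
    · rw [hqv, hre]
    · intro e
      rw [div_eq_one_iff_eq (h0 s)]
      simp [hv₁, hk0 s e]
    · rw [hqv]; exact L₁.re_eq s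
  simp only [hratio]
  by_cases hw : (v₁ s).im = 0
  -- A horizontal vector does not turn, but it cannot point straight down either, so the inequality
  -- was already strict.
  · have hlt : θ s + (v₁ s / v s).arg < a := by
      refine lt_of_le_of_ne step₁ fun e => ?_
      have := L₁.im_eq s
      simp only [e, hw, ha] at this
      have := norm_pos_iff.2 (h01 s)
      linarith
    simpa [hw] using hlt
  · have : (1 + ((v₁ s).im : ℂ) / v₁ s).arg < 0 := by
      rw [Complex.arg_neg_iff, himr]
      have := Complex.normSq_pos.2 (h01 s)
      have : 0 < (v₁ s).im ^ 2 := by positivity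
      exact neg_neg_of_pos (by positivity)
    linarith

/-! ### Area preservation on the cylinder -/

section CylinderMeasure

open MeasureTheory Set

/-- The lift of the standard map to the plane `ℂ`, followed by the horizontal translation `-c`. -/
noncomputable def planeMap (ε c : ℝ) : ℂ ≃ₜ ℂ where
  toFun z := ⟨z.re + (z.im + ε * Real.sin z.re) - c, z.im + ε * Real.sin z.re⟩
  invFun z := ⟨z.re - z.im + c, z.im - ε * Real.sin (z.re - z.im + c)⟩
  left_inv z := by
    have : z.re + (z.im + ε * Real.sin z.re) - c - (z.im + ε * Real.sin z.re) + c = z.re := by ring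
    simp [this]
  right_inv z := by
    apply Complex.ext <;> simp
    ring
  continuous_toFun := by
    simp only [Complex.mk_eq_add_mul_I]
    fun_prop
  continuous_invFun := by
    simp only [Complex.mk_eq_add_mul_I]
    fun_prop

@[simp]
theorem planeMap_re (ε c : ℝ) (z : ℂ) :
    (planeMap ε c z).re = z.re + (z.im + ε * Real.sin z.re) - c := rfl

@[simp]
theorem planeMap_im (ε c : ℝ) (z : ℂ) : (planeMap ε c z).im = z.im + ε * Real.sin z.re := rfl

@[simp]
theorem planeMap_symm_re (ε c : ℝ) (z : ℂ) : ((planeMap ε c).symm z).re = z.re - z.im + c := rfl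

@[simp]
theorem planeMap_symm_im (ε c : ℝ) (z : ℂ) :
    ((planeMap ε c).symm z).im = z.im - ε * Real.sin (z.re - z.im + c) := rfl

theorem planeMap_add_period (ε c : ℝ) {L : ℝ} (hL : Function.Periodic Real.sin L) (z : ℂ) :
    planeMap ε c (z + L) = planeMap ε c z + L := by
  apply Complex.ext <;> simp [hL z.re]
  ring

/-- The projection of the plane onto the cylinder of circumference `L`. -/
def cylinderProj (L : ℝ) (z : ℂ) : AddCircle L × ℝ := ((z.re : AddCircle L), z.im)

/-- A set that is invariant under the horizontal translation by `L`. -/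
def IsTranslationInvariant (L : ℝ) (S : Set ℂ) : Prop := ∀ z : ℂ, z + L ∈ S ↔ z ∈ S

theorem isOpenMap_cylinderProj (L : ℝ) : IsOpenMap (cylinderProj L) := by
  have h1 : IsOpenMap fun x : ℝ => (x : AddCircle L) := QuotientAddGroup.isOpenMap_coe
  have h2 := h1.prodMap (IsOpenMap.id (X := ℝ))
  exact h2.comp Complex.equivRealProdCLM.toHomeomorph.isOpenMap

theorem surjective_cylinderProj (L : ℝ) : Function.Surjective (cylinderProj L) := by
  rintro ⟨x, y⟩
  obtain ⟨x, rfl⟩ := QuotientAddGroup.mk_surjective x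
  exact ⟨⟨x, y⟩, rfl⟩

theorem cylinderProj_eq {L : ℝ} {z z' : ℂ} (h : cylinderProj L z = cylinderProj L z') :
    ∃ n : ℤ, z' = z + (n * L : ℝ) := by
  simp only [cylinderProj, Prod.mk.injEq] at h
  have h0 : ((z'.re - z.re : ℝ) : AddCircle L) = 0 := by
    rw [AddCircle.coe_sub, h.1, sub_self]
  obtain ⟨n, hn⟩ := (AddCircle.coe_eq_zero_iff L).1 h0
  rw [zsmul_eq_mul] at hn
  refine ⟨n, Complex.ext ?_ ?_⟩
  · rw [Complex.add_re, Complex.ofReal_re]; linarith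
  · rw [Complex.add_im, Complex.ofReal_im, ← h.2, add_zero]

theorem IsTranslationInvariant.add_int {L : ℝ} {S : Set ℂ} (h : IsTranslationInvariant L S)
    (n : ℤ) (z : ℂ) : z + (n * L : ℝ) ∈ S ↔ z ∈ S := by
  induction n with
  | zero => simp
  | succ n ih =>
    rw [← ih, ← h (z + (((n : ℤ) : ℝ) * L : ℝ))]
    push_cast
    rw [add_mul, one_mul, add_assoc]
  | pred n ih =>
    rw [← ih, ← h]
    push_cast
    ring_nf

theorem IsTranslationInvariant.mem_iff {L : ℝ} {S : Set ℂ} (h : IsTranslationInvariant L S)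
    {z z' : ℂ} (hz : cylinderProj L z = cylinderProj L z') : z ∈ S ↔ z' ∈ S := by
  obtain ⟨n, rfl⟩ := cylinderProj_eq hz
  exact (h.add_int n z).symm

theorem IsTranslationInvariant.proj_mem_image {L : ℝ} {S : Set ℂ} (h : IsTranslationInvariant L S)
    {z : ℂ} : cylinderProj L z ∈ cylinderProj L '' S ↔ z ∈ S :=
  ⟨fun ⟨_, hw, e⟩ => (h.mem_iff e).1 hw, fun hz => mem_image_of_mem _ hz⟩

/-- The map of the cylinder of circumference `L` induced by `planeMap ε c`. -/
noncomputable def cylinderMap {L : ℝ} (ε c : ℝ) (hL : Function.Periodic Real.sin L) (p : AddCircle L × ℝ) :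
    AddCircle L × ℝ :=
  (p.1 + ((p.2 + ε * hL.lift p.1 - c : ℝ) : AddCircle L), p.2 + ε * hL.lift p.1)

theorem cylinderMap_proj {L : ℝ} (ε c : ℝ) (hL : Function.Periodic Real.sin L) (z : ℂ) :
    cylinderMap ε c hL (cylinderProj L z) = cylinderProj L (planeMap ε c z) := by
  refine Prod.ext ?_ rfl
  change ((z.re : AddCircle L) + ((z.im + ε * Real.sin z.re - c : ℝ) : AddCircle L)) =
    ((z.re + (z.im + ε * Real.sin z.re) - c : ℝ) : AddCircle L)
  rw [show z.re + (z.im + ε * Real.sin z.re) - c = z.re + (z.im + ε * Real.sin z.re - c) by ring]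
  rfl

/-- The map is a composition of two shears, each of which translates the fibres of a product and so
preserves the product measure by Fubini. -/
theorem measurePreserving_cylinderMap {L : ℝ} [Fact (0 < L)] (ε c : ℝ) (hL : Function.Periodic Real.sin L) :
    MeasurePreserving (cylinderMap ε c hL) (volume : Measure (AddCircle L × ℝ)) volume := by
  have hlift : Continuous (hL.lift : AddCircle L → ℝ) :=
    continuous_coinduced_dom.mpr Real.continuous_sin
  have h1 : MeasurePreserving (fun p : AddCircle L × ℝ => (p.1, p.2 + ε * hL.lift p.1))
      (volume.prod volume) (volume.prod volume) := by
    refine (MeasurePreserving.id volume).skew_product (g := fun x y => y + ε * hL.lift x) ?_ ?_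
    · apply Continuous.measurable
      exact continuous_snd.add (continuous_const.mul (hlift.comp continuous_fst))
    · exact ae_of_all _ fun x => (measurePreserving_add_right volume _).map_eq
  have h2 : MeasurePreserving
      (fun p : ℝ × AddCircle L => (p.1, p.2 + ((p.1 - c : ℝ) : AddCircle L)))
      (volume.prod volume) (volume.prod volume) := by
    refine (MeasurePreserving.id volume).skew_product
      (g := fun y x => x + ((y - c : ℝ) : AddCircle L)) ?_ ?_
    · apply Continuous.measurable
      have : Continuous fun x : ℝ => (x : AddCircle L) := AddCircle.continuous_mk' L
      exact continuous_snd.add (this.comp (continuous_fst.sub continuous_const))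
    · exact ae_of_all _ fun x => (measurePreserving_add_right volume _).map_eq
  exact (Measure.measurePreserving_swap.comp (h2.comp Measure.measurePreserving_swap)).comp h1

theorem image_preimage_planeMap {L : ℝ} (ε c : ℝ) (hL : Function.Periodic Real.sin L) {S : Set ℂ}
    (hS : IsTranslationInvariant L S) :
    cylinderProj L '' (planeMap ε c ⁻¹' S) = cylinderMap ε c hL ⁻¹' (cylinderProj L '' S) := by
  ext p
  obtain ⟨z, rfl⟩ := surjective_cylinderProj L p
  have hinv : IsTranslationInvariant L (planeMap ε c ⁻¹' S) := fun z => by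
    rw [mem_preimage, planeMap_add_period ε c hL]
    exact hS _
  rw [hinv.proj_mem_image, mem_preimage, mem_preimage, cylinderMap_proj, hS.proj_mem_image]

theorem volume_image_preimage_planeMap {L : ℝ} [Fact (0 < L)] (ε c : ℝ) (hL : Function.Periodic Real.sin L) {S : Set ℂ}
    (hS : IsTranslationInvariant L S) (hm : MeasurableSet (cylinderProj L '' S)) :
    volume (cylinderProj L '' (planeMap ε c ⁻¹' S)) = volume (cylinderProj L '' S) := by
  rw [image_preimage_planeMap ε c hL hS]
  exact (measurePreserving_cylinderMap ε c hL).measure_preimage hm.nullMeasurableSet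

theorem volume_image_lt_top {L : ℝ} [Fact (0 < L)] {S : Set ℂ} {a b : ℝ} (h : ∀ z ∈ S, z.im ∈ Icc a b) :
    volume (cylinderProj L '' S) < ⊤ := by
  have hsub : cylinderProj L '' S ⊆ univ ×ˢ Icc a b := by
    rintro _ ⟨z, hz, rfl⟩
    exact ⟨mem_univ _, h z hz⟩
  refine (measure_mono hsub).trans_lt ?_
  rw [Measure.volume_eq_prod, Measure.prod_prod]
  exact ENNReal.mul_lt_top (measure_lt_top _ _) (by simp)

/-- A translation invariant open set between two sets of equal finite area is empty. -/
theorem isOpen_eq_empty_of_volume_eq {L : ℝ} [Fact (0 < L)] {S R O : Set ℂ} (hSR : S ⊆ R)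
    (hS : IsTranslationInvariant L S) (hm : MeasurableSet (cylinderProj L '' S))
    (hfin : volume (cylinderProj L '' S) < ⊤)
    (hv : volume (cylinderProj L '' R) = volume (cylinderProj L '' S))
    (hO : IsOpen O) (hOR : O ⊆ R \ S) : O = ∅ := by
  have hnull : volume (cylinderProj L '' R \ cylinderProj L '' S) = 0 := by
    rw [measure_sdiff (image_mono hSR) hm.nullMeasurableSet hfin.ne, hv, tsub_self]
  have hsub : cylinderProj L '' O ⊆ cylinderProj L '' R \ cylinderProj L '' S := by
    rintro _ ⟨z, hz, rfl⟩
    exact ⟨mem_image_of_mem _ (hOR hz).1, fun h => (hOR hz).2 (hS.proj_mem_image.1 h)⟩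
  have h0 := measure_mono_null hsub hnull
  have := (isOpenMap_cylinderProj L O hO).measure_eq_zero_iff (μ := volume) |>.1 h0
  exact image_eq_empty.1 this

end CylinderMeasure

/-! ### The region below a periodic line -/

section BelowTheLine

open MeasureTheory Set

theorem measurableSet_image_sdiff {L : ℝ} {U V : Set ℂ} (hU : IsOpen U) (hV : IsOpen V)
    (hVi : IsTranslationInvariant L V) : MeasurableSet (cylinderProj L '' (U \ V)) := by
  have : cylinderProj L '' (U \ V) = cylinderProj L '' U \ cylinderProj L '' V := by
    ext p
    constructor
    · rintro ⟨z, ⟨hzU, hzV⟩, rfl⟩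
      exact ⟨mem_image_of_mem _ hzU, fun h => hzV (hVi.proj_mem_image.1 h)⟩
    · rintro ⟨⟨z, hzU, rfl⟩, hzV⟩
      exact ⟨z, ⟨hzU, fun h => hzV (mem_image_of_mem _ h)⟩, rfl⟩
  rw [this]
  exact (isOpenMap_cylinderProj L U hU).measurableSet.diff
    (isOpenMap_cylinderProj L V hV).measurableSet

theorem IsTranslationInvariant.sdiff {L : ℝ} {U V : Set ℂ} (hU : IsTranslationInvariant L U)
    (hV : IsTranslationInvariant L V) : IsTranslationInvariant L (U \ V) := fun z => by
  simp only [Set.mem_sdiff, hU z, hV z]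

theorem IsTranslationInvariant.preimage_planeMap {L : ℝ} (ε c : ℝ)
    (hL : Function.Periodic Real.sin L) {S : Set ℂ} (hS : IsTranslationInvariant L S) :
    IsTranslationInvariant L (planeMap ε c ⁻¹' S) := fun z => by
  rw [mem_preimage, planeMap_add_period ε c hL]
  exact hS _

/-- If the area preserving map sends the complement of an open set `V` in a connected open set `U`
into the interior of this complement, then the complement is empty. -/
theorem subset_of_sdiff_subset_preimage {L : ℝ} [Fact (0 < L)] {ε c : ℝ}
    (hL : Function.Periodic Real.sin L) {U V A : Set ℂ} (hU : IsOpen U) (hUc : IsPreconnected U)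
    (hUi : IsTranslationInvariant L U) (hV : IsOpen V)
    (hVi : IsTranslationInvariant L V) (hne : (U ∩ V).Nonempty) (hA : IsOpen A)
    (hAi : IsTranslationInvariant L A) (hAs : A ⊆ U \ V) {a b : ℝ}
    (hbd : ∀ z ∈ U \ V, z.im ∈ Icc a b) (h : U \ V ⊆ planeMap ε c ⁻¹' A) : U ⊆ V := by
  have hm := measurableSet_image_sdiff hU hV hVi
  have hv := volume_image_preimage_planeMap ε c hL hAi
    (isOpenMap_cylinderProj L A hA).measurableSet
  -- The preimage of `A` contains `U \ V`, which contains `A`, and all three have the same finite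
  -- area; the open excess inside `V` is therefore empty. Then `V` and the preimage of `A` are
  -- disjoint open sets covering the connected `U`.
  have hO : planeMap ε c ⁻¹' A ∩ V = ∅ := by
    refine isOpen_eq_empty_of_volume_eq h (hUi.sdiff hVi) hm (volume_image_lt_top hbd) ?_
      ((hA.preimage (planeMap ε c).continuous).inter hV)
      fun z hz => ⟨hz.1, fun hz' => hz'.2 hz.2⟩
    exact le_antisymm (hv.le.trans (measure_mono (image_mono hAs))) (measure_mono (image_mono h))
  refine hUc.subset_left_of_subset_union hV (hA.preimage (planeMap ε c).continuous) ?_ ?_ hne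
  · rw [Set.disjoint_iff_inter_eq_empty, inter_comm]; exact hO
  · intro z hz
    by_cases hzV : z ∈ V
    · exact Or.inl hzV
    · exact Or.inr (h ⟨hz, hzV⟩)

/-- The counterpart for the inverse map: the area argument applies to the preimage of `U \ V`, and
`U` is invariant. -/
theorem subset_of_preimage_sdiff_subset {L : ℝ} [Fact (0 < L)] {ε c : ℝ}
    (hL : Function.Periodic Real.sin L) {U V A : Set ℂ} (hU : IsOpen U) (hUc : IsPreconnected U)
    (hUe : planeMap ε c ⁻¹' U = U) (hUi : IsTranslationInvariant L U) (hV : IsOpen V)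
    (hVi : IsTranslationInvariant L V) (hne : (U ∩ V).Nonempty) (hA : IsOpen A)
    (hAs : A ⊆ U \ V) {a b : ℝ}
    (hbd : ∀ z ∈ U \ V, z.im ∈ Icc a b) (h : planeMap ε c ⁻¹' (U \ V) ⊆ A) : U ⊆ V := by
  have hm := measurableSet_image_sdiff hU hV hVi
  have hv := volume_image_preimage_planeMap ε c hL (hUi.sdiff hVi) hm
  have hfin := volume_image_lt_top (L := L) hbd
  have hVo : IsOpen (planeMap ε c ⁻¹' V) := hV.preimage (planeMap ε c).continuous
  have hO : planeMap ε c ⁻¹' V ∩ A = ∅ := by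
    refine isOpen_eq_empty_of_volume_eq h ((hUi.sdiff hVi).preimage_planeMap ε c hL) ?_
      (hv.trans_lt hfin) ?_ (hVo.inter hA) fun z hz => ⟨hz.2, fun hz' => hz'.2 hz.1⟩
    · exact measurableSet_image_sdiff (hU.preimage (planeMap ε c).continuous) hVo
        (hVi.preimage_planeMap ε c hL)
    · exact le_antisymm ((measure_mono (image_mono hAs)).trans hv.ge) (measure_mono (image_mono h))
  have hsub : U ⊆ planeMap ε c ⁻¹' V := by
    refine hUc.subset_left_of_subset_union hVo hA (Set.disjoint_iff_inter_eq_empty.2 hO) ?_ ?_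
    · intro z hz
      rw [← hUe] at hz
      by_cases hzV : planeMap ε c z ∈ V
      · exact Or.inl hzV
      · exact Or.inr (h ⟨hz, hzV⟩)
    · obtain ⟨z, hzU, hzV⟩ := hne
      refine ⟨(planeMap ε c).symm z, ?_, ?_⟩
      · rw [← hUe]; simpa using hzU
      · simpa using hzV
  intro z hz
  have : (planeMap ε c).symm z ∈ U := by rw [← hUe]; simpa using hz
  simpa using hsub this

/-- A properly embedded line in the plane that is periodic in the horizontal direction. -/
structure IsPeriodicLine (L D : ℝ) (γ : ℝ → ℂ) : Prop where
  pos : 0 < L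
  cont : Continuous γ
  inj : Function.Injective γ
  add_one : ∀ s, γ (s + 1) = γ s + L
  bound : ∀ s, ‖γ s - (L * s : ℝ)‖ ≤ D

namespace IsPeriodicLine

variable {L D : ℝ} {γ : ℝ → ℂ}

theorem abs_im_le (h : IsPeriodicLine L D γ) (s : ℝ) : |(γ s).im| ≤ D := by
  have := (Complex.abs_im_le_norm _).trans (h.bound s)
  simpa using this

theorem abs_re_sub_le (h : IsPeriodicLine L D γ) (s : ℝ) : |(γ s).re - L * s| ≤ D := by
  have := (Complex.abs_re_le_norm _).trans (h.bound s)
  simpa using this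

theorem tendsto_norm_top (h : IsPeriodicLine L D γ) : Tendsto (fun s => ‖γ s‖) atTop atTop := by
  refine tendsto_atTop_mono (fun s => ?_)
    (tendsto_atTop_add_const_right _ (-D) (tendsto_id.const_mul_atTop h.pos))
  have h1 := (abs_le.1 (h.abs_re_sub_le s)).1
  have h2 := (le_abs_self _).trans (Complex.abs_re_le_norm (γ s))
  simp only [id]
  linarith

theorem tendsto_norm_bot (h : IsPeriodicLine L D γ) : Tendsto (fun s => ‖γ s‖) atBot atTop := by
  refine tendsto_atTop_mono (fun s => ?_)
    (tendsto_atTop_add_const_right _ (-D) (tendsto_neg_atBot_atTop.const_mul_atTop h.pos))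
  have h1 := (abs_le.1 (h.abs_re_sub_le s)).2
  have h2 := (neg_le_abs _).trans (Complex.abs_re_le_norm (γ s))
  simp only [mul_neg]
  linarith

theorem tendsto_norm_sub (h : IsPeriodicLine L D γ) (p : ℂ) :
    Tendsto (fun s => ‖γ s - p‖) atTop atTop ∧ Tendsto (fun s => ‖γ s - p‖) atBot atTop := by
  have : ∀ s, ‖γ s‖ + -‖p‖ ≤ ‖γ s - p‖ := fun s => by
    have := norm_sub_norm_le (γ s) p
    linarith
  exact ⟨tendsto_atTop_mono this (tendsto_atTop_add_const_right _ _ h.tendsto_norm_top),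
    tendsto_atTop_mono this (tendsto_atTop_add_const_right _ _ h.tendsto_norm_bot)⟩

/-- The line is proper because its norm tends to infinity at both ends. Continuity of parameters can
then be read off in the plane. -/
theorem isClosedEmbedding (h : IsPeriodicLine L D γ) : IsClosedEmbedding γ := by
  refine .of_continuous_injective_isClosedMap h.cont h.inj (IsProperMap.isClosedMap ?_)
  rw [isProperMap_iff_tendsto_cocompact]
  refine ⟨h.cont, ?_⟩
  rw [cocompact_eq_atBot_atTop, ← Metric.cobounded_eq_cocompact, ← comap_norm_atTop,
    tendsto_comap_iff]
  exact h.tendsto_norm_bot.sup h.tendsto_norm_top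

theorem isClosed_range (h : IsPeriodicLine L D γ) : IsClosed (range γ) :=
  h.isClosedEmbedding.isClosed_range

/-- The component below the line. -/
def below (D : ℝ) (γ : ℝ → ℂ) : Set ℂ := connectedComponentIn (range γ)ᶜ ⟨0, -(D + 1)⟩

theorem isOpen_below (h : IsPeriodicLine L D γ) : IsOpen (below D γ) :=
  h.isClosed_range.isOpen_compl.connectedComponentIn

theorem isPreconnected_below : IsPreconnected (below D γ) := isPreconnected_connectedComponentIn

theorem notMem_range_of_mem_below {p : ℂ} (hp : p ∈ below D γ) : p ∉ range γ :=
  connectedComponentIn_subset _ _ hp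

theorem mem_below_of_im_lt (h : IsPeriodicLine L D γ) {p : ℂ} (hp : p.im < -D) :
    p ∈ below D γ := by
  have hc : IsPreconnected {z : ℂ | z.im < -D} := (convex_halfSpace_im_lt _).isPreconnected
  refine hc.subset_connectedComponentIn (x := ⟨0, -(D + 1)⟩) ?_ ?_ hp
  · simp
  · rintro z hz ⟨s, rfl⟩
    have := (abs_le.1 (h.abs_im_le s)).1
    simp only [mem_ofPred_eq] at hz
    linarith

theorem subset_below {S : Set ℂ} (hS : IsPreconnected S) (hSγ : S ⊆ (range γ)ᶜ)
    (hne : (S ∩ below D γ).Nonempty) : S ⊆ below D γ := by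
  obtain ⟨z, hzS, hz⟩ := hne
  have := hS.subset_connectedComponentIn hzS hSγ
  rwa [← connectedComponentIn_eq hz] at this

/-- The image of the region is connected and avoids the line, so one point that stays in the region
keeps the whole image there. -/
theorem mapsTo_below {e : ℂ → ℂ} (he : Continuous e) (hγ : ∀ z, e z ∈ range γ → z ∈ range γ)
    {z : ℂ} (hz : z ∈ below D γ) (hez : e z ∈ below D γ) : MapsTo e (below D γ) (below D γ) := by
  rw [mapsTo_iff_image_subset]
  refine subset_below (isPreconnected_below.image _ he.continuousOn) ?_ ⟨_, ⟨z, hz, rfl⟩, hez⟩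
  rintro _ ⟨w, hw, rfl⟩ hw'
  exact notMem_range_of_mem_below hw (hγ _ hw')

theorem sub_one (h : IsPeriodicLine L D γ) (s : ℝ) : γ (s - 1) = γ s - L := by
  have := h.add_one (s - 1)
  rw [sub_add_cancel] at this
  rw [this]; ring

theorem below_isTranslationInvariant (h : IsPeriodicLine L D γ) :
    IsTranslationInvariant L (below D γ) := by
  have hb : (⟨0, -(D + 1)⟩ : ℂ) ∈ below D γ := h.mem_below_of_im_lt (by simp)
  have h1 : MapsTo (fun z : ℂ => z + L) (below D γ) (below D γ) := by
    refine mapsTo_below (by fun_prop) ?_ hb (h.mem_below_of_im_lt (by simp))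
    rintro z ⟨s, hs⟩
    exact ⟨s - 1, by rw [h.sub_one, hs]; ring⟩
  have h2 : MapsTo (fun z : ℂ => z - L) (below D γ) (below D γ) := by
    refine mapsTo_below (by fun_prop) ?_ hb (h.mem_below_of_im_lt (by simp))
    rintro z ⟨s, hs⟩
    exact ⟨s + 1, by rw [h.add_one, hs]; ring⟩
  intro z
  refine ⟨fun hz => ?_, fun hz => h1 hz⟩
  simpa using h2 hz

theorem preimage_planeMap_below (h : IsPeriodicLine L D γ) {ε c : ℝ} {f : ℝ ≃o ℝ}
    (hf : ∀ s, planeMap ε c (γ s) = γ (f s)) : planeMap ε c ⁻¹' (below D γ) = below D γ := by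
  have hb : (⟨0, -(D + 1)⟩ : ℂ) ∈ below D γ := h.mem_below_of_im_lt (by simp)
  -- The base point has abscissa 0, where the sine vanishes, so its height is unchanged and its
  -- image is still far below.
  have hb' : planeMap ε c ⟨0, -(D + 1)⟩ ∈ below D γ := h.mem_below_of_im_lt (by simp)
  have h1 : MapsTo (planeMap ε c) (below D γ) (below D γ) := by
    refine mapsTo_below (planeMap ε c).continuous ?_ hb hb'
    rintro z ⟨s, hs⟩
    refine ⟨f.symm s, (planeMap ε c).injective ?_⟩
    rw [hf, f.apply_symm_apply, hs]
  have h2 : MapsTo (planeMap ε c).symm (below D γ) (below D γ) := by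
    refine mapsTo_below (planeMap ε c).symm.continuous ?_ hb' (by simpa using hb)
    rintro z ⟨s, hs⟩
    refine ⟨f s, ?_⟩
    rw [← hf, hs, Homeomorph.apply_symm_apply]
  ext z
  refine ⟨fun hz => ?_, fun hz => h1 hz⟩
  simpa using h2 hz

end IsPeriodicLine

end BelowTheLine

/-! ### Angles of the line seen from points below it -/

section AnglesFromBelow

open MeasureTheory Set

namespace IsPeriodicLine

variable {L D : ℝ} {γ : ℝ → ℂ}

theorem sub_ne_zero {p : ℂ} (hp : p ∉ range γ) (s : ℝ) : γ s - p ≠ 0 :=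
  fun h => hp ⟨s, _root_.sub_eq_zero.1 h⟩

theorem exists_dist_pos (h : IsPeriodicLine L D γ) {p : ℂ} (hp : p ∉ range γ) :
    ∃ r > 0, ∀ s, r ≤ ‖γ s - p‖ := by
  obtain ⟨r, hr, hball⟩ := Metric.isOpen_iff.1 h.isClosed_range.isOpen_compl p hp
  refine ⟨r, hr, fun s => ?_⟩
  by_contra! hlt
  exact hball (by rwa [Metric.mem_ball, dist_eq_norm]) ⟨s, rfl⟩

/-- Lifts of the angle of `γ - p` are transferred to points close to `p`. -/
theorem angleLift_transfer (h : IsPeriodicLine L D γ) {p p' : ℂ} {θ : ℝ → ℝ} {r : ℝ}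
    (hθ : IsAngleLift (fun s => γ s - p) θ) (hr : 0 < r) (hp : ∀ s, r ≤ ‖γ s - p‖)
    (hpp : ‖p - p'‖ < r) :
    IsAngleLift (fun s => γ s - p') (fun s => θ s + (1 + (p - p') / (γ s - p)).arg) := by
  have h0 : ∀ s, γ s - p ≠ 0 := fun s => norm_pos_iff.1 (hr.trans_le (hp s))
  have e : ∀ s, γ s - p' = (γ s - p) + (p - p') := fun s => by ring
  have e' : ∀ s, (γ s - p') / (γ s - p) = 1 + (p - p') / (γ s - p) := fun s => by
    rw [e, add_div, div_self (h0 s)]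
  have hc := h.cont
  have := hθ.perturb (v' := fun s => γ s - p') (by fun_prop) (by fun_prop) h0 ?_ ?_ ?_
  · simpa only [e'] using this
  · intro s
    rw [e']
    apply Complex.mem_slitPlane_of_norm_lt_one
    rw [norm_div, div_lt_one (hr.trans_le (hp s))]
    exact hpp.trans_le (hp s)
  · simp only [e]
    exact tendsto_add_div_self (h.tendsto_norm_sub p).1 fun _ => le_rfl
  · simp only [e]
    exact tendsto_add_div_self (h.tendsto_norm_sub p).2 fun _ => le_rfl

/-- The angle depends continuously on the viewpoint, uniformly along the line, because the line
keeps a positive distance from `p`. Openness of conditions on angles rests on this. -/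
theorem eventually_exists_angleLift (h : IsPeriodicLine L D γ) {p : ℂ} (hp : p ∉ range γ)
    {θ : ℝ → ℝ} (hθ : IsAngleLift (fun s => γ s - p) θ) {δ : ℝ} (hδ : 0 < δ) :
    ∀ᶠ p' in 𝓝 p, ∃ θ', IsAngleLift (fun s => γ s - p') θ' ∧ ∀ s, |θ' s - θ s| < δ := by
  obtain ⟨r, hr, hrs⟩ := h.exists_dist_pos hp
  have harg : Tendsto (fun z : ℂ => (1 + z).arg) (𝓝 0) (𝓝 0) := by
    have h1 := (Complex.continuousAt_arg (x := 1 + 0) (by simp)).tendsto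
    have h2 : Tendsto (fun z : ℂ => 1 + z) (𝓝 0) (𝓝 (1 + 0)) := tendsto_id.const_add 1
    have := h1.comp h2
    rw [add_zero, Complex.arg_one] at this
    exact this
  obtain ⟨κ, hκ, hκs⟩ := Metric.tendsto_nhds_nhds.1 harg δ hδ
  have hev : ∀ᶠ p' in 𝓝 p, ‖p - p'‖ < r * min κ 1 := by
    have hpos : 0 < r * min κ 1 := by positivity
    filter_upwards [Metric.ball_mem_nhds p hpos] with p' hp'
    rwa [Metric.mem_ball, dist_comm, dist_eq_norm] at hp'
  filter_upwards [hev] with p' hp'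
  have h1 : ‖p - p'‖ < r := hp'.trans_le (mul_le_of_le_one_right hr.le (min_le_right _ _))
  refine ⟨_, h.angleLift_transfer hθ hr hrs h1, fun s => ?_⟩
  have h2 : ‖(p - p') / (γ s - p)‖ < κ := by
    rw [norm_div, div_lt_iff₀ (hr.trans_le (hrs s))]
    calc ‖p - p'‖ < r * min κ 1 := hp'
      _ ≤ r * κ := by gcongr; exact min_le_left _ _
      _ ≤ ‖γ s - p‖ * κ := by gcongr; exact hrs s
      _ = _ := mul_comm _ _
  have := hκs (x := (p - p') / (γ s - p)) (by simpa using h2)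
  simpa using this

theorem exists_angleLift_of_im_lt (h : IsPeriodicLine L D γ) {p : ℂ} (hp : p.im < -D) :
    ∃ θ, IsAngleLift (fun s => γ s - p) θ := by
  have hc := h.cont
  have hd : ∀ s, ‖γ s - p - (L * s : ℝ)‖ ≤ D + ‖p‖ := fun s => by
    have e : γ s - p - (L * s : ℝ) = (γ s - (L * s : ℝ)) - p := by ring
    rw [e]
    exact (norm_sub_le _ _).trans (by gcongr; exact h.bound s)
  have hn : ∀ s : ℝ, ‖((L * s : ℝ) : ℂ)‖ = L * |s| := fun s => by
    rw [Complex.norm_real, Real.norm_eq_abs, abs_mul, abs_of_pos h.pos]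
  refine ⟨_, isAngleLift_arg h.pos (by fun_prop) (fun s => ?_) ?_ ?_⟩
  · have := (abs_le.1 (h.abs_im_le s)).1
    rw [Complex.sub_im]
    linarith
  · have := tendsto_add_div_self (v := fun s : ℝ => ((L * s : ℝ) : ℂ)) (l := atTop) ?_ hd
    · simpa only [add_sub_cancel] using this
    · simp only [hn]
      exact tendsto_abs_atTop_atTop.const_mul_atTop h.pos
  · have := tendsto_add_div_self (v := fun s : ℝ => ((L * s : ℝ) : ℂ)) (l := atBot) ?_ hd
    · simpa only [add_sub_cancel] using this
    · simp only [hn]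
      exact tendsto_abs_atBot_atTop.const_mul_atTop h.pos

/-- Existence of a lift is an open and closed condition off the line, and far below the line the
principal argument is a lift; connectedness of the region does the rest. -/
theorem exists_angleLift (h : IsPeriodicLine L D γ) {p : ℂ} (hp : p ∈ below D γ) :
    ∃ θ, IsAngleLift (fun s => γ s - p) θ := by
  have hR := h.isClosed_range.isOpen_compl
  have hu : IsOpen {p ∈ (range γ)ᶜ | ∃ θ, IsAngleLift (fun s => γ s - p) θ} := by
    rw [isOpen_iff_mem_nhds]
    rintro p ⟨hp, θ, hθ⟩
    filter_upwards [hR.mem_nhds hp, h.eventually_exists_angleLift hp hθ one_pos] with p' h1 h2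
    exact ⟨h1, h2.imp fun _ => And.left⟩
  -- A lift at a nearby `p'` could be carried back to `p`: within half the distance from `p` to the
  -- line, `p'` is itself at least that half away from the line.
  have hv : IsOpen {p ∈ (range γ)ᶜ | ¬ ∃ θ, IsAngleLift (fun s => γ s - p) θ} := by
    rw [isOpen_iff_mem_nhds]
    rintro p ⟨hp, hθ⟩
    obtain ⟨r, hr, hrs⟩ := h.exists_dist_pos hp
    filter_upwards [hR.mem_nhds hp, Metric.ball_mem_nhds p (half_pos hr)] with p' h1 h2
    rw [Metric.mem_ball, dist_eq_norm] at h2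
    refine ⟨h1, fun ⟨θ', hθ'⟩ => hθ ⟨_, h.angleLift_transfer hθ' (half_pos hr) (fun s => ?_) h2⟩⟩
    have e : γ s - p = (γ s - p') + (p' - p) := by ring
    have := norm_add_le (γ s - p') (p' - p)
    rw [← e] at this
    linarith [hrs s]
  have := isPreconnected_below.subset_left_of_subset_union (s := below D γ) hu hv
    ?_ ?_ ?_ hp
  · exact this.2
  · rw [Set.disjoint_left]
    rintro p ⟨_, h1⟩ ⟨_, h2⟩
    exact h2 h1
  · intro p hp
    have hp' := notMem_range_of_mem_below hp
    by_cases hθ : ∃ θ, IsAngleLift (fun s => γ s - p) θ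
    · exact Or.inl ⟨hp', hθ⟩
    · exact Or.inr ⟨hp', hθ⟩
  · have him : (⟨0, -(D + 1)⟩ : ℂ).im < -D := by simp
    have hb := h.mem_below_of_im_lt him
    exact ⟨_, hb, notMem_range_of_mem_below hb, h.exists_angleLift_of_im_lt him⟩

/-- In coordinates centred at `p` the map is a vertical shear by `ε (sin x - sin p.re)`, which
vanishes on the vertical through `p`, followed by a horizontal shear, so `IsAngleLift.twist`
applies. The reparametrization by `f` accounts for the motion along the line. -/
theorem angleLift_planeMap (h : IsPeriodicLine L D γ) {ε c : ℝ} {f : ℝ ≃o ℝ}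
    (hf : ∀ s, planeMap ε c (γ s) = γ (f s)) {p : ℂ} (hp : p ∉ range γ) {θ : ℝ → ℝ}
    (hθ : IsAngleLift (fun s => γ s - p) θ) :
    ∃ θ', IsAngleLift (fun s => γ s - planeMap ε c p) θ' ∧
      ∀ a, Real.sin a = -1 → ∀ s, θ s ≤ a → θ' (f s) < a := by
  have hc := h.cont
  have hcre : Continuous fun s => (γ s).re := Complex.continuous_re.comp hc
  have hk0 : ∀ s, (γ s - p).re = 0 → ε * (Real.sin (γ s).re - Real.sin p.re) = 0 := by
    intro s hs
    rw [Complex.sub_re, _root_.sub_eq_zero] at hs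
    simp [hs]
  have hD := (abs_nonneg _).trans (h.abs_im_le 0)
  have hkD : ∀ s, |ε * (Real.sin (γ s).re - Real.sin p.re)| ≤ D + |p.im| + |ε| * 2 := by
    intro s
    have h1 : |Real.sin (γ s).re - Real.sin p.re| ≤ 2 := by
      have a1 := abs_le.1 (Real.abs_sin_le_one (γ s).re)
      have a2 := abs_le.1 (Real.abs_sin_le_one p.re)
      rw [abs_le]; constructor <;> linarith [a1.1, a1.2, a2.1, a2.2]
    rw [abs_mul]
    have := mul_le_mul_of_nonneg_left h1 (abs_nonneg ε)
    have := abs_nonneg p.im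
    linarith
  have hvD : ∀ s, |(γ s - p).im| ≤ D + |p.im| + |ε| * 2 := by
    intro s
    rw [Complex.sub_im]
    have h1 := abs_sub (γ s).im p.im
    have := h.abs_im_le s
    have := abs_nonneg ε
    linarith
  obtain ⟨θ', hθ', hlt⟩ := hθ.twist (by fun_prop) (sub_ne_zero hp) (by fun_prop) hk0 hkD hvD
    (h.tendsto_norm_sub p).1 (h.tendsto_norm_sub p).2
  refine ⟨θ' ∘ f.symm, ?_, fun a ha s hs => by simpa using hlt a ha s hs⟩
  have := hθ'.comp f.symm.continuous f.symm.tendsto_atTop f.symm.tendsto_atBot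
  convert this using 2 with s
  simp only [Function.comp]
  have e := hf (f.symm s)
  rw [f.apply_symm_apply] at e
  rw [← e]
  apply Complex.ext
  · simp only [planeMap_re, Complex.sub_re, Complex.add_re, Complex.mul_re, Complex.ofReal_re,
      Complex.ofReal_im, Complex.I_re, Complex.I_im, Complex.sub_im]
    ring
  · simp only [planeMap_im, Complex.sub_im, Complex.add_im, Complex.mul_im, Complex.ofReal_re,
      Complex.ofReal_im, Complex.I_re, Complex.I_im]
    ring

theorem angleLift_translate (h : IsPeriodicLine L D γ) {p : ℂ} {θ : ℝ → ℝ}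
    (hθ : IsAngleLift (fun s => γ s - p) θ) :
    IsAngleLift (fun s => γ s - (p + L)) (fun s => θ (s - 1)) ∧
      IsAngleLift (fun s => γ s - (p - L)) (fun s => θ (s + 1)) := by
  have e1 : (fun s => γ s - (p + L)) = (fun s => γ s - p) ∘ fun s => s - 1 := by
    funext s
    simp only [Function.comp, h.sub_one]
    ring
  have e2 : (fun s => γ s - (p - L)) = (fun s => γ s - p) ∘ fun s => s + 1 := by
    funext s
    simp only [Function.comp, h.add_one]
    ring
  rw [e1, e2]
  exact ⟨hθ.comp (by fun_prop) (tendsto_atTop_add_const_right _ (-1) tendsto_id)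
      (tendsto_atBot_add_const_right _ (-1) tendsto_id),
    hθ.comp (by fun_prop) (tendsto_atTop_add_const_right _ 1 tendsto_id)
      (tendsto_atBot_add_const_right _ 1 tendsto_id)⟩

/-- The angle runs from π to 0, hence takes the value π/2: some point of the line is directly above
`p`. -/
theorem im_le_of_mem_below (h : IsPeriodicLine L D γ) {p : ℂ} (hp : p ∈ below D γ) :
    p.im ≤ D := by
  by_contra! hlt
  obtain ⟨θ, hθ⟩ := h.exists_angleLift hp
  have hpi := Real.pi_pos
  have h1 : ∃ s, θ s < Real.pi / 2 :=
    (hθ.top.eventually (gt_mem_nhds (by linarith))).exists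
  have h2 : ∃ s, Real.pi / 2 < θ s :=
    (hθ.bot.eventually (lt_mem_nhds (by linarith))).exists
  obtain ⟨s1, h1⟩ := h1
  obtain ⟨s2, h2⟩ := h2
  obtain ⟨s, hs⟩ := mem_range_of_exists_le_of_exists_ge hθ.cont ⟨s1, h1.le⟩ ⟨s2, h2.le⟩
  have h3 := hθ.im_eq s
  rw [hs, Real.sin_pi_div_two, Complex.sub_im, mul_one] at h3
  have h4 := norm_nonneg (γ s - p)
  have := (abs_le.1 (h.abs_im_le s)).2
  linarith

/-- For a point below the whole line the lifted angles stay between the downward verticals. -/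
theorem angle_mem_Ioo_of_im_lt (h : IsPeriodicLine L D γ) {p : ℂ} (hp : p.im < -D) {θ : ℝ → ℝ}
    (hθ : IsAngleLift (fun s => γ s - p) θ) (s : ℝ) :
    -(Real.pi / 2) < θ s ∧ θ s < 3 * Real.pi / 2 := by
  have hpi := Real.pi_pos
  have key : ∀ a, Real.sin a = -1 → ∀ t, θ t ≠ a := by
    intro a ha t ht
    have h3 := hθ.im_eq t
    rw [ht, ha, Complex.sub_im] at h3
    have h4 := norm_nonneg (γ t - p)
    have := (abs_le.1 (h.abs_im_le t)).1
    linarith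
  have s1 : Real.sin (-(Real.pi / 2)) = -1 := by simp
  have s2 : Real.sin (3 * Real.pi / 2) = -1 := by
    rw [show 3 * Real.pi / 2 = Real.pi / 2 + Real.pi by ring, Real.sin_add_pi]; simp
  obtain ⟨t1, h1⟩ := (hθ.top.eventually (Ioo_mem_nhds (a := -(Real.pi / 2))
    (b := 3 * Real.pi / 2) (by linarith) (by linarith))).exists
  constructor
  · by_contra! hle
    obtain ⟨t, ht⟩ := mem_range_of_exists_le_of_exists_ge hθ.cont ⟨s, hle⟩ ⟨t1, h1.1.le⟩
    exact key _ s1 t ht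
  · by_contra! hle
    obtain ⟨t, ht⟩ := mem_range_of_exists_le_of_exists_ge hθ.cont ⟨t1, h1.2.le⟩ ⟨s, hle⟩
    exact key _ s2 t ht

end IsPeriodicLine

end AnglesFromBelow

/-! ### No point of the line beneath a point of the lower region -/

section BirkhoffGraph

open MeasureTheory Set

/-- Near both ends `g` stays away from `a`, and in between the infimum is attained. A uniform gap is
what makes the condition on all angles open in the viewpoint. -/
theorem exists_gt_of_forall_lt {g : ℝ → ℝ} (hg : Continuous g) {a l₁ l₂ : ℝ}
    (ht : Tendsto g atTop (𝓝 l₁)) (hb : Tendsto g atBot (𝓝 l₂)) (h₁ : a < l₁) (h₂ : a < l₂)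
    (h : ∀ s, a < g s) : ∃ b, a < b ∧ ∀ s, b ≤ g s := by
  obtain ⟨m, ham, hm⟩ := exists_between (lt_min h₁ h₂)
  by_cases hall : ∀ s, m ≤ g s
  · exact ⟨m, ham, hall⟩
  push Not at hall
  obtain ⟨s₀, hs₀⟩ := hall
  have hev : ∀ᶠ s in cocompact ℝ, g s₀ ≤ g s := by
    rw [cocompact_eq_atBot_atTop, eventually_sup]
    have e1 := hb.eventually (lt_mem_nhds (hm.trans_le (min_le_right _ _)))
    have e2 := ht.eventually (lt_mem_nhds (hm.trans_le (min_le_left _ _)))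
    exact ⟨e1.mono fun s hs => (hs₀.trans hs).le, e2.mono fun s hs => (hs₀.trans hs).le⟩
  obtain ⟨x, hx⟩ := hg.exists_forall_le' s₀ hev
  exact ⟨g x, h x, hx⟩

namespace IsPeriodicLine

variable {L D : ℝ} {γ : ℝ → ℂ}

theorem angleLift_unique {p : ℂ} (hp : p ∈ below D γ) {θ θ' : ℝ → ℝ}
    (hθ : IsAngleLift (fun s => γ s - p) θ) (hθ' : IsAngleLift (fun s => γ s - p) θ') : θ = θ' :=
  hθ.unique hθ' (sub_ne_zero (notMem_range_of_mem_below hp))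

theorem isOpen_setOf_forall_lt (h : IsPeriodicLine L D γ) {a : ℝ} (ha : a < 0) :
    IsOpen {p ∈ below D γ | ∀ θ, IsAngleLift (fun s => γ s - p) θ → ∀ s, a < θ s} := by
  rw [isOpen_iff_mem_nhds]
  rintro p ⟨hp, hall⟩
  obtain ⟨θ, hθ⟩ := h.exists_angleLift hp
  obtain ⟨b, hab, hb⟩ := exists_gt_of_forall_lt hθ.cont hθ.top hθ.bot ha
    (ha.trans Real.pi_pos) (hall θ hθ)
  filter_upwards [h.isOpen_below.mem_nhds hp,
    h.eventually_exists_angleLift (notMem_range_of_mem_below hp) hθ (sub_pos.2 hab)]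
    with p' hp' ⟨θ', hθ', hlt⟩
  refine ⟨hp', fun θ'' hθ'' s => ?_⟩
  rw [angleLift_unique hp' hθ'' hθ']
  have := (abs_lt.1 (hlt s)).1
  have := hb s
  linarith

theorem isOpen_setOf_forall_gt (h : IsPeriodicLine L D γ) {a : ℝ} (ha : Real.pi < a) :
    IsOpen {p ∈ below D γ | ∀ θ, IsAngleLift (fun s => γ s - p) θ → ∀ s, θ s < a} := by
  rw [isOpen_iff_mem_nhds]
  rintro p ⟨hp, hall⟩
  obtain ⟨θ, hθ⟩ := h.exists_angleLift hp
  obtain ⟨b, hab, hb⟩ := exists_gt_of_forall_lt hθ.cont.neg hθ.top.neg hθ.bot.neg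
    (a := -a) (by linarith [Real.pi_pos]) (by linarith) fun s => neg_lt_neg (hall θ hθ s)
  filter_upwards [h.isOpen_below.mem_nhds hp,
    h.eventually_exists_angleLift (notMem_range_of_mem_below hp) hθ
      (show 0 < b + a by linarith)]
    with p' hp' ⟨θ', hθ', hlt⟩
  refine ⟨hp', fun θ'' hθ'' s => ?_⟩
  rw [angleLift_unique hp' hθ'' hθ']
  have := (abs_lt.1 (hlt s)).2
  have hbs : b ≤ -θ s := hb s
  linarith

theorem isOpen_setOf_exists (h : IsPeriodicLine L D γ) {I : Set ℝ} (hI : IsOpen I) :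
    IsOpen {p ∈ below D γ | ∃ θ, IsAngleLift (fun s => γ s - p) θ ∧ ∃ s, θ s ∈ I} := by
  rw [isOpen_iff_mem_nhds]
  rintro p ⟨hp, θ, hθ, s, hs⟩
  obtain ⟨δ, hδ, hball⟩ := Metric.isOpen_iff.1 hI _ hs
  filter_upwards [h.isOpen_below.mem_nhds hp,
    h.eventually_exists_angleLift (notMem_range_of_mem_below hp) hθ hδ]
    with p' hp' ⟨θ', hθ', hlt⟩
  exact ⟨hp', θ', hθ', s, hball (by rw [Metric.mem_ball, Real.dist_eq]; exact hlt s)⟩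

theorem isTranslationInvariant_setOf_forall (h : IsPeriodicLine L D γ) (I : Set ℝ) :
    IsTranslationInvariant L
      {p ∈ below D γ | ∀ θ, IsAngleLift (fun s => γ s - p) θ → ∀ s, θ s ∈ I} := by
  intro p
  have hU := h.below_isTranslationInvariant p
  constructor
  · rintro ⟨hp, hall⟩
    refine ⟨hU.1 hp, fun θ hθ s => ?_⟩
    simpa using hall _ (h.angleLift_translate hθ).1 (s + 1)
  · rintro ⟨hp, hall⟩
    refine ⟨hU.2 hp, fun θ hθ s => ?_⟩
    have := (h.angleLift_translate hθ).2
    rw [add_sub_cancel_right] at this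
    simpa using hall _ this (s - 1)

theorem isTranslationInvariant_setOf_exists (h : IsPeriodicLine L D γ) (I : Set ℝ) :
    IsTranslationInvariant L
      {p ∈ below D γ | ∃ θ, IsAngleLift (fun s => γ s - p) θ ∧ ∃ s, θ s ∈ I} := by
  intro p
  have hU := h.below_isTranslationInvariant p
  constructor
  · rintro ⟨hp, θ, hθ, s, hs⟩
    have := (h.angleLift_translate hθ).2
    rw [add_sub_cancel_right] at this
    exact ⟨hU.1 hp, _, this, s - 1, by simpa using hs⟩
  · rintro ⟨hp, θ, hθ, s, hs⟩
    exact ⟨hU.2 hp, _, (h.angleLift_translate hθ).1, s + 1, by simpa using hs⟩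

/-- Seen from a point below an invariant line, no point of the line lies directly beneath. -/
theorem angle_mem_Ioo (h : IsPeriodicLine L D γ) (hL : Function.Periodic Real.sin L) {ε c : ℝ}
    {f : ℝ ≃o ℝ} (hf : ∀ s, planeMap ε c (γ s) = γ (f s)) {p : ℂ} (hp : p ∈ below D γ)
    {θ : ℝ → ℝ} (hθ : IsAngleLift (fun s => γ s - p) θ) (s : ℝ) :
    -(Real.pi / 2) < θ s ∧ θ s < 3 * Real.pi / 2 := by
  have : Fact (0 < L) := ⟨h.pos⟩
  have hpi := Real.pi_pos
  have s1 : Real.sin (-(Real.pi / 2)) = -1 := by simp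
  have s2 : Real.sin (3 * Real.pi / 2) = -1 := by
    rw [show 3 * Real.pi / 2 = Real.pi / 2 + Real.pi by ring, Real.sin_add_pi]; simp
  have hUe := h.preimage_planeMap_below hf
  have hb : (⟨0, -(D + 1)⟩ : ℂ).im < -D := by simp
  have hmap : ∀ z, z ∈ below D γ → planeMap ε c z ∈ below D γ := fun z hz => by
    rw [← hUe] at hz; exact hz
  have hmap' : ∀ z, planeMap ε c z ∈ below D γ → z ∈ below D γ := fun z hz => by
    rw [← hUe]; exact hz
  constructor
  -- Forward argument: a viewpoint with an angle at most -π/2 is sent to one with an angle strictly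
  -- below it, which is an open condition.
  · refine (subset_of_sdiff_subset_preimage (ε := ε) (c := c) hL h.isOpen_below isPreconnected_below
      h.below_isTranslationInvariant (h.isOpen_setOf_forall_lt (a := -(Real.pi / 2)) (by linarith))
      (h.isTranslationInvariant_setOf_forall (Ioi (-(Real.pi / 2))))
      ⟨_, h.mem_below_of_im_lt hb, h.mem_below_of_im_lt hb,
        fun θ hθ s => (h.angle_mem_Ioo_of_im_lt hb hθ s).1⟩
      (h.isOpen_setOf_exists (isOpen_Iio (a := -(Real.pi / 2))))
      (h.isTranslationInvariant_setOf_exists (Iio (-(Real.pi / 2)))) ?_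
      (a := -D) (b := D) ?_ ?_ hp).2 θ hθ s
    · rintro z ⟨hz, θ, hθ, s, hs⟩
      exact ⟨hz, fun hz' => lt_asymm hs (hz'.2 θ hθ s)⟩
    · rintro z ⟨hz, hz'⟩
      refine ⟨?_, h.im_le_of_mem_below hz⟩
      by_contra! hlt
      exact hz' ⟨hz, fun θ hθ s => (h.angle_mem_Ioo_of_im_lt hlt hθ s).1⟩
    · rintro z ⟨hz, hz'⟩
      have : ∃ θ, IsAngleLift (fun s => γ s - z) θ ∧ ∃ s, θ s ≤ -(Real.pi / 2) := by
        by_contra! hcon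
        exact hz' ⟨hz, hcon⟩
      obtain ⟨θ, hθ, s, hs⟩ := this
      obtain ⟨θ', hθ', hlt⟩ := h.angleLift_planeMap hf (notMem_range_of_mem_below hz) hθ
      exact ⟨hmap z hz, θ', hθ', f s, hlt _ s1 s hs⟩
  -- Backward argument: by contraposition of the twist, an angle at least 3π/2 at the image comes
  -- from an angle strictly above it.
  · refine (subset_of_preimage_sdiff_subset (ε := ε) (c := c) hL h.isOpen_below isPreconnected_below hUe
      h.below_isTranslationInvariant
      (h.isOpen_setOf_forall_gt (a := 3 * Real.pi / 2) (by linarith))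
      (h.isTranslationInvariant_setOf_forall (Iio (3 * Real.pi / 2)))
      ⟨_, h.mem_below_of_im_lt hb, h.mem_below_of_im_lt hb,
        fun θ hθ s => (h.angle_mem_Ioo_of_im_lt hb hθ s).2⟩
      (h.isOpen_setOf_exists (isOpen_Ioi (a := 3 * Real.pi / 2))) ?_
      (a := -D) (b := D) ?_ ?_ hp).2 θ hθ s
    · rintro z ⟨hz, θ, hθ, s, hs⟩
      exact ⟨hz, fun hz' => lt_asymm hs (hz'.2 θ hθ s)⟩
    · rintro z ⟨hz, hz'⟩
      refine ⟨?_, h.im_le_of_mem_below hz⟩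
      by_contra! hlt
      exact hz' ⟨hz, fun θ hθ s => (h.angle_mem_Ioo_of_im_lt hlt hθ s).2⟩
    · rintro z ⟨hz, hz'⟩
      have hzU := hmap' z hz
      obtain ⟨θ, hθ⟩ := h.exists_angleLift hzU
      obtain ⟨θ', hθ', hlt⟩ := h.angleLift_planeMap hf (notMem_range_of_mem_below hzU) hθ
      refine ⟨hzU, θ, hθ, ?_⟩
      by_contra! hcon
      refine hz' ⟨hz, fun θ'' hθ'' s => ?_⟩
      rw [angleLift_unique hz hθ'' hθ']
      simpa using hlt _ s2 (f.symm s) (not_lt.1 fun hh => hcon _ hh)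

/-- A point of the line beneath `p` would be seen at an angle with zero cosine and nonpositive sine,
but π/2 is the only zero of the cosine in (-π/2, 3π/2). The descending ray thus never meets the
line. -/
theorem down_mem_below (h : IsPeriodicLine L D γ) (hL : Function.Periodic Real.sin L) {ε c : ℝ}
    {f : ℝ ≃o ℝ} (hf : ∀ s, planeMap ε c (γ s) = γ (f s)) {p : ℂ} (hp : p ∈ below D γ)
    {y : ℝ} (hy : y ≤ p.im) : (⟨p.re, y⟩ : ℂ) ∈ below D γ := by
  set g : ℝ → ℂ := fun y => p.re + y * Complex.I with hg
  have hgy : ∀ y : ℝ, g y = ⟨p.re, y⟩ := fun y => by apply Complex.ext <;> simp [hg]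
  have hconn : IsPreconnected (g '' Iic p.im) :=
    isPreconnected_Iic.image _ (by fun_prop)
  rw [← hgy]
  refine subset_below hconn ?_ ⟨p, ⟨p.im, self_mem_Iic, hgy _⟩, hp⟩ ⟨y, hy, rfl⟩
  rintro _ ⟨t, ht, rfl⟩ ⟨s, hs⟩
  obtain ⟨θ, hθ⟩ := h.exists_angleLift hp
  have hI := h.angle_mem_Ioo hL hf hp hθ s
  have hne := norm_pos_iff.2 (sub_ne_zero (notMem_range_of_mem_below hp) s)
  rw [hgy] at hs
  have hr := hθ.re_eq s
  have hi := hθ.im_eq s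
  simp only [hs, Complex.sub_re, Complex.sub_im, sub_self] at hr hi hne
  have hcos : Real.cos (θ s) = 0 := by
    rcases mul_eq_zero.1 hr.symm with h | h
    · exact absurd h hne.ne'
    · exact h
  have hsin : Real.sin (θ s) ≤ 0 := by
    by_contra! hpos
    have := mul_pos hne hpos
    have : t ≤ p.im := ht
    linarith
  obtain ⟨n, hn⟩ := Real.cos_eq_zero_iff.1 hcos
  have hpi := Real.pi_pos
  have n1 : (-1 : ℝ) < n := by
    have := hI.1
    rw [hn] at this
    by_contra! hle
    nlinarith
  have n2 : (n : ℝ) < 1 := by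
    have := hI.2
    rw [hn] at this
    by_contra! hle
    nlinarith
  have hn0 : n = 0 := by
    have n1' : (-1 : ℤ) < n := by exact_mod_cast n1
    have n2' : n < (1 : ℤ) := by exact_mod_cast n2
    omega
  rw [hn, hn0] at hsin
  norm_num at hsin

/-- The region below an invariant line contains a cone beneath each of its points. -/
theorem cone_mem_below (h : IsPeriodicLine L D γ) (hL : Function.Periodic Real.sin L) {ε c : ℝ}
    {f : ℝ ≃o ℝ} (hf : ∀ s, planeMap ε c (γ s) = γ (f s)) {p : ℂ} (hp : p ∈ below D γ)
    {x y : ℝ} (hy : y ≤ p.im - (1 + |ε|) * |x - p.re|) : (⟨x, y⟩ : ℂ) ∈ below D γ := by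
  have hUe := h.preimage_planeMap_below hf
  rcases le_total x p.re with hx | hx
  -- The map sends the vertical segment beneath the preimage of `p` to a segment of slope 1
  -- descending to the left of `p`.
  · have hq : (planeMap ε c).symm p ∈ below D γ := by rw [← hUe]; simpa using hp
    have h1 := h.down_mem_below hL hf hq (y := ((planeMap ε c).symm p).im - (p.re - x))
      (by linarith)
    rw [← hUe, mem_preimage] at h1
    have h2 := h.down_mem_below hL hf h1 (y := y) (by
      rw [abs_of_nonpos (sub_nonpos.2 hx)] at hy
      simp only [planeMap_symm_im, planeMap_symm_re, planeMap_im]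
      have := mul_nonneg (abs_nonneg ε) (sub_nonneg.2 hx)
      linarith)
    convert h2 using 2
    simp only [planeMap_symm_im, planeMap_symm_re, planeMap_re]
    ring
  -- The inverse sends the vertical segment beneath the image of `p` to a curve descending to the
  -- right of `p`; the term `ε sin` costs the extra `|ε|` in the slope.
  · have hq : planeMap ε c p ∈ below D γ := by rw [← hUe] at hp; exact hp
    have h1 := h.down_mem_below hL hf hq (y := (planeMap ε c p).im - (x - p.re)) (by linarith)
    have h1' : (planeMap ε c).symm ⟨(planeMap ε c p).re, (planeMap ε c p).im - (x - p.re)⟩ ∈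
        below D γ := by
      rw [← hUe, mem_preimage, Homeomorph.apply_symm_apply]; exact h1
    have ex : p.re + (p.im + ε * Real.sin p.re) - c - (p.im + ε * Real.sin p.re - (x - p.re)) + c
        = x := by ring
    have h2 := h.down_mem_below hL hf h1' (y := y) (by
      rw [abs_of_nonneg (sub_nonneg.2 hx)] at hy
      simp only [planeMap_symm_im, planeMap_re, planeMap_im, ex]
      have hsin : |ε * (Real.sin x - Real.sin p.re)| ≤ |ε| * (x - p.re) := by
        rw [abs_mul]
        gcongr
        have := Real.abs_sin_sub_sin_le x p.re
        rwa [abs_of_nonneg (sub_nonneg.2 hx)] at this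
      have := (abs_le.1 hsin).2
      linarith)
    convert h2 using 2
    simp only [planeMap_symm_re, planeMap_re, planeMap_im, ex]

end IsPeriodicLine

end BirkhoffGraph

/-! ### Birkhoff's theorem for invariant lines -/

section BirkhoffGraphTheorem

open Set

namespace IsPeriodicLine

variable {L D : ℝ} {γ : ℝ → ℂ}

/-- Birkhoff's theorem: an invariant line of the standard map is the graph of a function. -/
theorem exists_graph (h : IsPeriodicLine L D γ) (hL : Function.Periodic Real.sin L) {ε c : ℝ}
    {f : ℝ ≃o ℝ} (hf : ∀ s, planeMap ε c (γ s) = γ (f s)) :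
    ∃ ψ : ℝ → ℝ, Continuous ψ ∧ (∀ s, (γ s).im = ψ (γ s).re) ∧ ∀ x, ∃ s, γ s = ⟨x, ψ x⟩ := by
  set ψ : ℝ → ℝ := fun x => sSup {y | (⟨x, y⟩ : ℂ) ∈ below D γ} with hψ
  have hbdd : ∀ x, BddAbove {y | (⟨x, y⟩ : ℂ) ∈ below D γ} := fun x =>
    ⟨D, fun y hy => h.im_le_of_mem_below hy⟩
  have hne : ∀ x, {y | (⟨x, y⟩ : ℂ) ∈ below D γ}.Nonempty := fun x =>
    ⟨-(D + 1), h.mem_below_of_im_lt (by simp)⟩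
  have hlt : ∀ x y, y < ψ x → (⟨x, y⟩ : ℂ) ∈ below D γ := fun x y hy => by
    obtain ⟨b, hb, hyb⟩ := exists_lt_of_lt_csSup (hne x) hy
    exact h.down_mem_below hL hf (p := ⟨x, b⟩) hb hyb.le
  have hle : ∀ x y, (⟨x, y⟩ : ℂ) ∈ below D γ → y ≤ ψ x := fun x y hy => le_csSup (hbdd x) hy
  have hline : ∀ x : ℝ, Continuous fun y : ℝ => (⟨x, y⟩ : ℂ) := fun x => by
    simp only [Complex.mk_eq_add_mul_I]
    fun_prop
  have hnot : ∀ x, (⟨x, ψ x⟩ : ℂ) ∉ below D γ := fun x hx => by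
    have hev : ∀ᶠ y in 𝓝 (ψ x), (⟨x, y⟩ : ℂ) ∈ below D γ :=
      (h.isOpen_below.preimage (hline x)).mem_nhds hx
    obtain ⟨y, hy, hyψ⟩ := ((hev.filter_mono (nhdsWithin_le_nhds (s := Ioi (ψ x)))).and
      self_mem_nhdsWithin).exists
    exact not_lt.2 (hle x y hy) hyψ
  have hmem : ∀ x, ∃ s, γ s = ⟨x, ψ x⟩ := fun x => by
    by_contra hcon
    have hx : (⟨x, ψ x⟩ : ℂ) ∈ (range γ)ᶜ := hcon
    obtain ⟨r, hr, hball⟩ := Metric.isOpen_iff.1 h.isClosed_range.isOpen_compl _ hx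
    refine hnot x (subset_below (convex_ball _ _).isPreconnected hball ?_ (Metric.mem_ball_self hr))
    have hev : ∀ᶠ y in 𝓝 (ψ x), (⟨x, y⟩ : ℂ) ∈ Metric.ball (⟨x, ψ x⟩ : ℂ) r :=
      (hline x).continuousAt.preimage_mem_nhds (Metric.ball_mem_nhds _ hr)
    obtain ⟨y, hy, hyψ⟩ := ((hev.filter_mono (nhdsWithin_le_nhds (s := Iio (ψ x)))).and
      self_mem_nhdsWithin).exists
    exact ⟨_, hy, hlt x y hyψ⟩
  have hlip : ∀ x x', ψ x' ≤ ψ x + (1 + |ε|) * |x - x'| := fun x x' => by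
    refine le_of_forall_lt fun y hy => ?_
    obtain ⟨y', hy', hyψ⟩ := exists_between hy
    have := hle _ _ (h.cone_mem_below hL hf (hlt x' y' hyψ) (x := x)
      (y := y' - (1 + |ε|) * |x - x'|) le_rfl)
    linarith
  have hcont : Continuous ψ := by
    have hC : (0 : ℝ) ≤ 1 + |ε| := by positivity
    refine (LipschitzWith.of_dist_le_mul (K := ⟨1 + |ε|, hC⟩) fun x x' => ?_).continuous
    rw [Real.dist_eq, Real.dist_eq, abs_le]
    have h1 := hlip x x'
    have h2 := hlip x' x
    rw [abs_sub_comm x' x] at h2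
    constructor
    · change -((1 + |ε|) * |x - x'|) ≤ _
      linarith
    · change _ ≤ (1 + |ε|) * |x - x'|
      linarith
  -- The parameter over each abscissa is continuous and unbounded in both directions, hence onto:
  -- the line has no points off the graph.
  choose σ hσ using hmem
  have hσc : Continuous σ := by
    rw [h.isClosedEmbedding.isInducing.continuous_iff]
    have : γ ∘ σ = fun x : ℝ => (x : ℂ) + ψ x * Complex.I := by
      funext x
      rw [Function.comp, hσ, Complex.mk_eq_add_mul_I]
    rw [this]
    fun_prop
  have hσb : ∀ x, |x - L * σ x| ≤ D := fun x => by
    simpa [hσ] using h.abs_re_sub_le (σ x)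
  have hσt : Tendsto σ atTop atTop := by
    refine tendsto_atTop_mono (fun x => ?_)
      ((tendsto_atTop_add_const_right _ (-D) tendsto_id).atTop_div_const h.pos)
    rw [div_le_iff₀ h.pos]
    have := (abs_le.1 (hσb x)).2
    simp only [id]
    linarith
  have hσb : Tendsto σ atBot atBot := by
    refine tendsto_atBot_mono (fun x => ?_)
      ((tendsto_atBot_add_const_right _ D tendsto_id).atBot_div_const h.pos)
    rw [le_div_iff₀ h.pos]
    have := (abs_le.1 (hσb x)).1
    simp only [id]
    linarith
  refine ⟨ψ, hcont, fun s => ?_, fun x => ⟨σ x, hσ x⟩⟩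
  obtain ⟨x, rfl⟩ := hσc.surjective hσt hσb s
  rw [hσ]

end IsPeriodicLine

end BirkhoffGraphTheorem

/-! ### Lifts from the cylinder to the plane -/

section InvariantCircle

open Set

theorem standardMapLift_eq_planeMap (ε : ℝ) (p : ℝ × ℝ) :
    planeMap ε 0 ⟨p.1, p.2⟩ = ⟨(standardMapLift ε p).1, (standardMapLift ε p).2⟩ := by
  apply Complex.ext <;> simp [standardMapLift]
  ring

theorem toCylinder_eq_iff {p q : ℝ × ℝ} :
    toCylinder p = toCylinder q ↔ ∃ j : ℤ, p = q + (2 * Real.pi * j, 0) := by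
  simp only [toCylinder, Prod.mk.injEq, Real.Angle.angle_eq_iff_two_pi_dvd_sub]
  constructor
  · rintro ⟨⟨j, hj⟩, h2⟩
    exact ⟨j, Prod.ext (by simp; linarith) (by simp [h2])⟩
  · rintro ⟨j, rfl⟩
    exact ⟨⟨j, by simp⟩, by simp⟩

/-- A homeomorphism-like self map of a line that commutes with the unit translation. -/
theorem exists_orderIso_of_continuous {f : ℝ → ℝ} (hf : Continuous f) (hi : Function.Injective f)
    (h1 : ∀ s, f (s + 1) = f s + 1) : ∃ e : ℝ ≃o ℝ, ∀ s, e s = f s := by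
  have hmono : StrictMono f := by
    rcases hf.strictMono_of_inj hi with h | h
    · exact h
    · have := h (show (0 : ℝ) < 0 + 1 by norm_num)
      rw [h1] at this
      linarith
  have hn : ∀ n : ℕ, f n = f 0 + n ∧ f (-n) = f 0 - n := by
    intro n
    induction n with
    | zero => simp
    | succ n ih =>
      have e := h1 (-((n + 1 : ℕ) : ℝ))
      push_cast at e ⊢
      rw [show -((n : ℝ) + 1) + 1 = -n by ring, ih.2] at e
      exact ⟨by rw [h1, ih.1]; ring, by linarith⟩
  have hsurj : Function.Surjective f := by
    intro y
    obtain ⟨n, hn'⟩ := exists_nat_ge |y - f 0|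
    have := abs_le.1 hn'
    exact mem_range_of_exists_le_of_exists_ge hf ⟨-n, by rw [(hn n).2]; linarith⟩
      ⟨n, by rw [(hn n).1]; linarith⟩
  exact ⟨hmono.orderIsoOfSurjective f hsurj, fun s => rfl⟩

end InvariantCircle

/-! ### Invariant circles: winding number one and the graph property -/

section InvariantCircleGraph

open Set

/-- A difference `ψ (x + T) - ψ x` without zeros has constant sign, so `ψ` is strictly monotone
along the multiples of `T`. This excludes winding numbers above 1. -/
theorem apply_two_pi_mul_ne_of_forall_ne {ψ : ℝ → ℝ} (hψ : Continuous ψ) {T : ℝ}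
    (hne : ∀ x, ψ (x + T) ≠ ψ x) {n : ℕ} (hn : 0 < n) : ψ (n * T) ≠ ψ 0 := by
  have key : ∀ φ : ℝ → ℝ, Continuous φ → (∀ x, φ (x + T) ≠ φ x) → φ 0 < φ (0 + T) →
      ∀ m : ℕ, φ 0 < φ ((m + 1 : ℕ) * T) := by
    intro φ hφ hne h0 m
    have hpos : ∀ x, φ x < φ (x + T) := by
      intro x
      by_contra! hle
      obtain ⟨t, ht⟩ := mem_range_of_exists_le_of_exists_ge
        (f := fun x => φ (x + T) - φ x) (c := 0) (by fun_prop)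
        ⟨x, by linarith⟩ ⟨0, by linarith⟩
      exact hne t (sub_eq_zero.1 ht)
    induction m with
    | zero => simpa using h0
    | succ m ih =>
      have := hpos ((m + 1 : ℕ) * T)
      rw [show ((m + 1 : ℕ) : ℝ) * T + T = (m + 1 + 1 : ℕ) * T by push_cast; ring] at this
      exact ih.trans this
  obtain ⟨m, rfl⟩ : ∃ m, n = m + 1 := ⟨n - 1, by omega⟩
  rcases lt_or_gt_of_ne (hne 0) with h | h
  · have := key (fun x => -ψ x) hψ.neg (fun x hx => hne x (neg_injective hx)) (by linarith) m
    exact (neg_lt_neg_iff.1 this).ne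
  · exact (key ψ hψ hne h m).ne'

/-- A simple closed curve in the cylinder with winding number `n`. -/
structure IsSimpleClosedLift (n : ℕ) (γ : ℝ → ℝ × ℝ) : Prop where
  cont : Continuous γ
  pos : 0 < n
  add_one : ∀ s, γ (s + 1) = γ s + (2 * Real.pi * n, 0)
  simple : ∀ s t, toCylinder (γ s) = toCylinder (γ t) → ∃ m : ℤ, t = s + m

theorem IsEssentialCircle.exists_isSimpleClosedLift {Γ : Set Cylinder} (h : IsEssentialCircle Γ) :
    ∃ (n : ℕ) (γ : ℝ → ℝ × ℝ), IsSimpleClosedLift n γ ∧ Γ = range fun s => toCylinder (γ s) := by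
  obtain ⟨γ, hγ, -, ⟨k, hk, hper⟩, hinj, rfl⟩ := h
  rcases lt_or_gt_of_ne hk with hk | hk
  · obtain ⟨n, rfl⟩ : ∃ n : ℕ, k = -n := ⟨k.natAbs, by omega⟩
    refine ⟨n, fun s => γ (-s), ⟨hγ.continuous.comp continuous_neg, by omega, fun s => ?_,
      fun s t hst => ?_⟩, ?_⟩
    · have := hper (-(s + 1))
      rw [show -(s + 1) + 1 = -s by ring] at this
      rw [this]
      ext <;> simp
    · obtain ⟨m, hm⟩ := hinj _ _ hst
      exact ⟨-m, by push_cast; linarith⟩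
    · ext p
      constructor
      · rintro ⟨s, rfl⟩
        exact ⟨-s, by simp⟩
      · rintro ⟨s, rfl⟩
        exact ⟨-s, rfl⟩
  · obtain ⟨n, rfl⟩ : ∃ n : ℕ, k = n := ⟨k.natAbs, by omega⟩
    exact ⟨n, γ, ⟨hγ.continuous, by omega, fun s => by simpa using hper s, hinj⟩, rfl⟩

namespace IsSimpleClosedLift

variable {n : ℕ} {γ : ℝ → ℝ × ℝ}

theorem add_int (h : IsSimpleClosedLift n γ) (s : ℝ) (m : ℤ) :
    γ (s + m) = γ s + (2 * Real.pi * n * m, 0) := by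
  have hG : Function.Periodic (fun s => γ s - (2 * Real.pi * n * s, 0)) 1 := fun s => by
    simp only [h.add_one]
    ext <;> simp
    ring
  have := hG.int_mul m s
  rw [mul_one] at this
  rw [sub_eq_iff_eq_add] at this
  rw [this]
  ext <;> simp
  ring

/-- The curve as a line in the complex plane. -/
def toLine (γ : ℝ → ℝ × ℝ) (s : ℝ) : ℂ := ⟨(γ s).1, (γ s).2⟩

theorem toLine_add_int (h : IsSimpleClosedLift n γ) (s : ℝ) (m : ℤ) :
    toLine γ (s + m) = toLine γ s + (2 * Real.pi * n * m : ℝ) := by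
  apply Complex.ext <;> simp only [toLine, h.add_int] <;> simp

theorem exists_int_of_toLine_eq (h : IsSimpleClosedLift n γ) {s t : ℝ} {j : ℤ}
    (e : toLine γ t = toLine γ s + (2 * Real.pi * j : ℝ)) : ∃ m : ℤ, t = s + m ∧ j = n * m := by
  have e1 := congrArg Complex.re e
  have e2 := congrArg Complex.im e
  simp only [toLine, Complex.add_re, Complex.add_im, Complex.ofReal_re, Complex.ofReal_im] at e1 e2
  have : toCylinder (γ t) = toCylinder (γ s) :=
    toCylinder_eq_iff.2 ⟨j, Prod.ext (by simpa using e1) (by simpa using e2)⟩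
  obtain ⟨m, rfl⟩ := h.simple _ _ this.symm
  refine ⟨m, rfl, ?_⟩
  rw [h.add_int] at e1
  have e3 : 2 * Real.pi * ((n : ℝ) * m) = 2 * Real.pi * j := by
    simp only [Prod.fst_add] at e1
    linarith
  have := mul_left_cancel₀ (by positivity) e3
  exact_mod_cast this.symm

theorem exists_isPeriodicLine (h : IsSimpleClosedLift n γ) :
    ∃ D, IsPeriodicLine (2 * Real.pi * n) D (toLine γ) := by
  have hc : Continuous (toLine γ) := by
    have := h.cont
    unfold toLine
    simp only [Complex.mk_eq_add_mul_I]
    fun_prop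
  have hper : ∀ s, toLine γ (s + 1) = toLine γ s + (2 * Real.pi * n : ℝ) := fun s => by
    simpa using h.toLine_add_int s 1
  have hG : Function.Periodic (fun s => toLine γ s - (2 * Real.pi * n * s : ℝ)) 1 := fun s => by
    simp only [hper]
    push_cast
    ring
  have hGc : Continuous fun s => toLine γ s - (2 * Real.pi * n * s : ℝ) := by fun_prop
  obtain ⟨D, hD⟩ := (isCompact_Icc (a := (0 : ℝ)) (b := 1)).exists_bound_of_continuousOn
    hGc.continuousOn
  have := h.pos
  refine ⟨D, by positivity, hc, fun s t hst => ?_, hper, fun s => ?_⟩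
  · obtain ⟨m, hm, h0⟩ := h.exists_int_of_toLine_eq (s := s) (t := t) (j := 0) (by simp [hst])
    have : m = 0 := by
      rcases mul_eq_zero.1 h0.symm with h | h
      · omega
      · exact h
    simp [hm, this]
  · obtain ⟨y, hy, he⟩ := hG.exists_mem_Ico₀ one_pos s
    rw [he]
    exact hD y (Ico_subset_Icc_self hy)

/-- The lifted map sends each point of the line to a translate of the line by a multiple of 2π, and
only the residue mod `n` matters. The parameters belonging to each residue form finitely many closed
sets, disjoint because the curve is simple, so a single residue serves the whole line. -/
theorem exists_conj (h : IsSimpleClosedLift n γ) {ε : ℝ}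
    (hinv : ∀ s, ∃ t, toCylinder (γ t) = standardMap ε (toCylinder (γ s))) :
    ∃ (c : ℝ) (f : ℝ ≃o ℝ), ∀ s, planeMap ε c (toLine γ s) = toLine γ (f s) := by
  obtain ⟨D, hline⟩ := h.exists_isPeriodicLine
  have hshift : ∀ (c : ℝ) (z : ℂ), planeMap ε c z = planeMap ε 0 z - c := fun c z => by
    apply Complex.ext <;> simp
  have hex : ∀ s, ∃ (i : Fin n) (t : ℝ), planeMap ε (2 * Real.pi * (i : ℕ)) (toLine γ s)
      = toLine γ t := by
    intro s
    obtain ⟨t, ht⟩ := hinv s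
    rw [← toCylinder_standardMapLift, eq_comm, toCylinder_eq_iff] at ht
    obtain ⟨j, hj⟩ := ht
    have hn : (0 : ℤ) < n := by exact_mod_cast h.pos
    have h1 := Int.emod_nonneg j hn.ne'
    have h2 := Int.emod_lt_of_pos j hn
    have h3 := Int.emod_add_mul_ediv j n
    -- The quotient of `j` by `n` is absorbed by whole turns of the parameter, and the remainder
    -- gives the translation.
    refine ⟨⟨(j % n).toNat, by omega⟩, t + (j / n : ℤ), ?_⟩
    have h4 : (((j % n).toNat : ℕ) : ℝ) = j - n * (j / n : ℤ) := by
      have : (((j % n).toNat : ℕ) : ℤ) = j - n * (j / n) := by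
        rw [Int.toNat_of_nonneg h1]; linarith
      exact_mod_cast this
    rw [hshift, h.toLine_add_int]
    have e : planeMap ε 0 (toLine γ s) = toLine γ t + (2 * Real.pi * j : ℝ) := by
      rw [toLine, standardMapLift_eq_planeMap]
      rw [hj]
      apply Complex.ext <;> simp [toLine]
    rw [e]
    simp only [h4]
    push_cast
    ring
  set A : Fin n → Set ℝ := fun i =>
    {s | planeMap ε (2 * Real.pi * (i : ℕ)) (toLine γ s) ∈ range (toLine γ)} with hA
  have hAc : ∀ i, IsClosed (A i) := fun i =>
    hline.isClosed_range.preimage ((planeMap ε _).continuous.comp hline.cont)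
  have hdisj : ∀ i i' s, s ∈ A i → s ∈ A i' → i = i' := by
    rintro i i' s ⟨t, ht⟩ ⟨t', ht'⟩
    have e : toLine γ t' = toLine γ t + (2 * Real.pi * ((i : ℕ) - (i' : ℕ) : ℤ) : ℝ) := by
      rw [ht, ht', hshift, hshift (2 * Real.pi * (i : ℕ))]
      push_cast
      ring
    obtain ⟨m, -, hm⟩ := h.exists_int_of_toLine_eq e
    have hi := i.2
    have hi' := i'.2
    have hm0 : m = 0 := by
      by_contra hne
      rcases lt_or_gt_of_ne hne with hlt | hlt
      · have : (n : ℤ) * m ≤ n * (-1) := by gcongr; omega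
        omega
      · have : (n : ℤ) * 1 ≤ n * m := by gcongr; omega
        omega
    rw [hm0] at hm
    exact Fin.ext (by omega)
  obtain ⟨i, t₀, ht₀⟩ := hex 0
  have hclopen : IsClopen (A i) := by
    refine ⟨hAc i, ?_⟩
    rw [← isClosed_compl_iff]
    have : (A i)ᶜ = ⋃ i' : {i' // i' ≠ i}, A i' := by
      ext s
      simp only [mem_compl_iff, mem_iUnion]
      constructor
      · intro hs
        obtain ⟨i', t, ht⟩ := hex s
        have hs' : s ∈ A i' := ⟨t, ht.symm⟩
        exact ⟨⟨i', fun e => hs (e ▸ hs')⟩, hs'⟩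
      · rintro ⟨⟨i', hne⟩, hs'⟩ hs
        exact hne (hdisj _ _ _ hs' hs)
    rw [this]
    exact isClosed_iUnion_of_finite fun i' => hAc i'
  have huniv := hclopen.eq_univ ⟨0, t₀, ht₀.symm⟩
  have hall : ∀ s, ∃ t, toLine γ t = planeMap ε (2 * Real.pi * (i : ℕ)) (toLine γ s) := fun s => by
    have : s ∈ A i := huniv ▸ mem_univ s
    exact this
  choose f hf using hall
  have hfc : Continuous f := by
    rw [hline.isClosedEmbedding.isInducing.continuous_iff]
    have : toLine γ ∘ f = fun s => planeMap ε (2 * Real.pi * (i : ℕ)) (toLine γ s) := funext hf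
    rw [this]
    exact (planeMap ε _).continuous.comp hline.cont
  have hfi : Function.Injective f := fun s t hst => by
    have := hf s
    rw [hst, hf t] at this
    exact (hline.inj ((planeMap ε _).injective this)).symm
  have hL : Function.Periodic Real.sin (2 * Real.pi * n) := fun x => by
    rw [mul_comm]; exact Real.sin_add_nat_mul_two_pi x n
  have hf1 : ∀ s, f (s + 1) = f s + 1 := fun s => by
    apply hline.inj
    rw [hf, hline.add_one, hline.add_one, planeMap_add_period ε _ hL, hf]
  obtain ⟨e, he⟩ := exists_orderIso_of_continuous hfc hfi hf1
  exact ⟨_, e, fun s => by rw [he, hf]⟩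

end IsSimpleClosedLift

/-- Birkhoff's theorem: an essential invariant circle of the standard map is a graph. -/
theorem IsInvariantCircle.exists_graph {ε : ℝ} {Γ : Set Cylinder} (h : IsInvariantCircle ε Γ) :
    ∃ ψ : ℝ → ℝ, Continuous ψ ∧ Function.Periodic ψ (2 * Real.pi) ∧
      ∀ p, toCylinder p ∈ Γ ↔ p.2 = ψ p.1 := by
  obtain ⟨hess, hT⟩ := h
  obtain ⟨n, γ, hγ, rfl⟩ := hess.exists_isSimpleClosedLift
  obtain ⟨D, hline⟩ := hγ.exists_isPeriodicLine
  obtain ⟨c, f, hf⟩ := hγ.exists_conj (ε := ε) fun s => by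
    have : standardMap ε (toCylinder (γ s)) ∈ range fun s => toCylinder (γ s) :=
      hT ▸ mem_image_of_mem _ ⟨s, rfl⟩
    exact this
  have hL : Function.Periodic Real.sin (2 * Real.pi * n) := fun x => by
    rw [mul_comm]; exact Real.sin_add_nat_mul_two_pi x n
  obtain ⟨ψ, hψ, hgr, hsurj⟩ := hline.exists_graph hL hf
  -- If `n` were larger, a coincidence `ψ (x + 2π) = ψ x` would be a self-intersection, so there is
  -- none; but the curve closes up after `2πn`.
  have hn : n = 1 := by
    by_contra hn1
    refine apply_two_pi_mul_ne_of_forall_ne hψ (T := 2 * Real.pi) (fun x hx => ?_) hγ.pos ?_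
    · obtain ⟨s, hs⟩ := hsurj x
      obtain ⟨t, ht⟩ := hsurj (x + 2 * Real.pi)
      obtain ⟨m, -, hm⟩ := hγ.exists_int_of_toLine_eq (s := s) (t := t) (j := 1) (by
        rw [hs, ht]
        apply Complex.ext <;> simp [hx])
      have := Int.isUnit_iff.1 (IsUnit.of_mul_eq_one _ hm.symm)
      omega
    · obtain ⟨s, hs⟩ := hsurj 0
      have e := hgr (s + 1)
      rw [hline.add_one, hs] at e
      simp only [Complex.add_re, Complex.add_im, Complex.ofReal_re, Complex.ofReal_im] at e
      rw [add_zero, zero_add] at e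
      rw [e, mul_comm]
  subst hn
  refine ⟨ψ, hψ, fun x => ?_, fun p => ⟨?_, fun hp => ?_⟩⟩
  · obtain ⟨s, hs⟩ := hsurj x
    have e := hgr (s + 1)
    rw [hline.add_one, hs] at e
    simpa using e.symm
  · rintro ⟨s, hs⟩
    obtain ⟨m, rfl⟩ := toCylinder_eq_iff.1 hs.symm
    have e := hgr (s + m)
    simp only [IsSimpleClosedLift.toLine, hγ.add_int] at e
    simpa using e
  · obtain ⟨s, hs⟩ := hsurj p.1
    refine ⟨s, congrArg toCylinder (Prod.ext ?_ ?_)⟩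
    · exact congrArg Complex.re hs
    · rw [hp]; exact congrArg Complex.im hs

end InvariantCircleGraph

/-! ### The rotation number on an invariant circle -/

section RotationNumber

theorem standardMapLift_injective (ε : ℝ) : Function.Injective (standardMapLift ε) := by
  rintro ⟨x, y⟩ ⟨x', y'⟩ h
  simp only [standardMapLift, Prod.mk.injEq] at h
  obtain ⟨h1, h2⟩ := h
  have hx : x = x' := by linarith
  subst hx
  exact Prod.ext rfl (by simpa using h2)

/-- On an invariant circle the rotation number exists, and the angle deviates from the
uniform rotation by at most one turn. -/
theorem IsInvariantCircle.exists_rotationNumber {ε : ℝ} {Γ : Set Cylinder}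
    (h : IsInvariantCircle ε Γ) {x y : ℝ} (hxy : toCylinder (x, y) ∈ Γ) :
    ∃ ω, HasRotationNumber ε x y ω ∧
      ∀ n : ℕ, |((standardMapLift ε)^[n] (x, y)).1 - x - n * (2 * Real.pi * ω)| ≤ 2 * Real.pi := by
  obtain ⟨ψ, hψ, hper, hΓ⟩ := h.exists_graph
  have hpi := Real.two_pi_pos
  set φ : ℝ → ℝ := fun x => x + ψ x + ε * Real.sin x with hφ
  have hF : ∀ x, standardMapLift ε (x, ψ x) = (φ x, ψ (φ x)) := by
    intro x
    have h1 : toCylinder (standardMapLift ε (x, ψ x)) ∈ Γ := by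
      rw [toCylinder_standardMapLift, ← h.2]
      exact Set.mem_image_of_mem _ ((hΓ _).2 rfl)
    exact Prod.ext rfl ((hΓ _).1 h1)
  have hφc : Continuous φ := by fun_prop
  have hφi : Function.Injective φ := by
    intro a b hab
    have : standardMapLift ε (a, ψ a) = standardMapLift ε (b, ψ b) := by rw [hF, hF, hab]
    exact congrArg Prod.fst (standardMapLift_injective ε this)
  have hφp : ∀ x, φ (x + 2 * Real.pi) = φ x + 2 * Real.pi := by
    intro x
    simp only [hφ, hper x, Real.sin_add_two_pi]
    ring
  have hmono : StrictMono φ := by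
    rcases hφc.strictMono_of_inj hφi with h | h
    · exact h
    · have := h (show (0 : ℝ) < 0 + 2 * Real.pi by linarith)
      rw [hφp] at this
      linarith
  -- The induced map of the angle, rescaled to period 1.
  let g : CircleDeg1Lift :=
    { toFun := fun u => φ (2 * Real.pi * u) / (2 * Real.pi)
      monotone' := fun u v huv => by
        have := hmono.monotone (mul_le_mul_of_nonneg_left huv hpi.le)
        dsimp only
        gcongr
      map_add_one' := fun u => by
        rw [mul_add, mul_one, hφp, add_div, div_self hpi.ne'] }
  have hg : ∀ u, g u = φ (2 * Real.pi * u) / (2 * Real.pi) := fun u => rfl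
  have hgn : ∀ (n : ℕ) u, (g ^ n) u = φ^[n] (2 * Real.pi * u) / (2 * Real.pi) := by
    intro n u
    rw [CircleDeg1Lift.coe_pow]
    have hs : Function.Semiconj (fun u : ℝ => 2 * Real.pi * u) g φ := fun u => by
      change 2 * Real.pi * g u = φ (2 * Real.pi * u)
      rw [hg]
      field_simp
    rw [← (hs.iterate_right n) u]
    field_simp
  have hFn : ∀ n : ℕ, (standardMapLift ε)^[n] (x, y) = (φ^[n] x, ψ (φ^[n] x)) := by
    intro n
    induction n with
    | zero => exact Prod.ext rfl ((hΓ _).1 hxy)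
    | succ n ih => rw [Function.iterate_succ_apply', ih, hF, Function.iterate_succ_apply']
  have hx : 2 * Real.pi * (x / (2 * Real.pi)) = x := by field_simp
  have hxn : ∀ n : ℕ, φ^[n] x - x =
      2 * Real.pi * ((g ^ n) (x / (2 * Real.pi)) - x / (2 * Real.pi)) := by
    intro n
    rw [hgn, hx]
    field_simp
  refine ⟨g.translationNumber, ?_, fun n => ?_⟩
  · have := (g.tendsto_translationNumber (x / (2 * Real.pi))).const_mul (2 * Real.pi)
    refine this.congr fun n => ?_
    rw [hFn, hxn]
    ring
  · rw [hFn, hxn]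
    -- The translation number of `g ^ n` lies between the floor and the ceiling of any displacement
    -- of `g ^ n`, hence within 1 of it.
    have h1 := (g ^ n).floor_sub_le_translationNumber (x / (2 * Real.pi))
    have h2 := (g ^ n).translationNumber_le_ceil_sub (x / (2 * Real.pi))
    rw [CircleDeg1Lift.translationNumber_pow] at h1 h2
    have h3 := Int.lt_floor_add_one ((g ^ n) (x / (2 * Real.pi)) - x / (2 * Real.pi))
    have h4 := Int.ceil_lt_add_one ((g ^ n) (x / (2 * Real.pi)) - x / (2 * Real.pi))
    have e : 2 * Real.pi * ((g ^ n) (x / (2 * Real.pi)) - x / (2 * Real.pi)) -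
        n * (2 * Real.pi * g.translationNumber) = 2 * Real.pi *
        ((g ^ n) (x / (2 * Real.pi)) - x / (2 * Real.pi) - n * g.translationNumber) := by ring
    rw [e, abs_mul, abs_of_pos hpi]
    refine mul_le_of_le_one_right hpi.le (abs_le.2 ⟨by linarith, by linarith⟩)

end RotationNumber

/-! ### A modified energy conserved to fifth order -/

section LinkEnergy

/-- The mean value inequality; iterated, it yields Taylor remainders with no attention to the best
constants. -/
theorem abs_le_mul_pow_of_hasDerivAt {g g' : ℝ → ℝ} {M : ℝ} {k : ℕ}
    (hg : ∀ t, HasDerivAt g (g' t) t) (h0 : g 0 = 0) (hM : ∀ t, |g' t| ≤ M * |t| ^ k) (t : ℝ) :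
    |g t| ≤ M * |t| ^ (k + 1) := by
  have hM0 : 0 ≤ M := by simpa using (abs_nonneg _).trans (hM 1)
  have := Convex.norm_image_sub_le_of_norm_hasDerivWithin_le (f := g) (f' := g')
    (s := Set.uIcc 0 t) (C := M * |t| ^ k) (x := 0) (y := t)
    (fun r _ => (hg r).hasDerivWithinAt) (fun r hr => ?_) (convex_uIcc 0 t)
    Set.left_mem_uIcc Set.right_mem_uIcc
  · rw [h0, sub_zero, sub_zero, Real.norm_eq_abs, Real.norm_eq_abs] at this
    rwa [pow_succ, ← mul_assoc]
  · refine (hM r).trans ?_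
    have : |r| ≤ |t| := by simpa using Set.abs_sub_left_of_mem_uIcc hr
    gcongr

theorem abs_cos_sub_one_le_sq (t : ℝ) : |Real.cos t - 1| ≤ |t| ^ 2 := by
  have := abs_le_mul_pow_of_hasDerivAt (g := fun t => Real.cos t - 1) (M := 1) (k := 1)
    (fun t => (Real.hasDerivAt_cos t).sub_const 1) (by simp)
    (fun t => by simpa using Real.abs_sin_le_abs) t
  simpa using this

theorem abs_sin_sub_self_le_pow (t : ℝ) : |Real.sin t - t| ≤ |t| ^ 3 := by
  have := abs_le_mul_pow_of_hasDerivAt (g := fun t => Real.sin t - t) (M := 1) (k := 2)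
    (fun t => (Real.hasDerivAt_sin t).sub (hasDerivAt_id t)) (by simp)
    (fun t => by rw [one_mul]; exact abs_cos_sub_one_le_sq t) t
  simpa using this

theorem abs_cos_sub_le_pow (t : ℝ) : |Real.cos t - 1 + t ^ 2 / 2| ≤ |t| ^ 4 := by
  have := abs_le_mul_pow_of_hasDerivAt (g := fun t => Real.cos t - 1 + t ^ 2 / 2) (M := 1) (k := 3)
    (fun t => ((Real.hasDerivAt_cos t).sub_const 1).add ((hasDerivAt_pow 2 t).div_const 2))
    (by simp)
    (fun t => by
      have e : -Real.sin t + ((2 : ℕ) : ℝ) * t ^ (2 - 1) / 2 = -(Real.sin t - t) := by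
        push_cast; ring
      rw [e, abs_neg, one_mul]; exact abs_sin_sub_self_le_pow t) t
  simpa using this

theorem abs_sin_sub_le_pow (t : ℝ) : |Real.sin t - t + t ^ 3 / 6| ≤ |t| ^ 5 := by
  have := abs_le_mul_pow_of_hasDerivAt (g := fun t => Real.sin t - t + t ^ 3 / 6) (M := 1) (k := 4)
    (fun t => ((Real.hasDerivAt_sin t).sub (hasDerivAt_id t)).add
      ((hasDerivAt_pow 3 t).div_const 6))
    (by simp)
    (fun t => by
      have e : Real.cos t - 1 + ((3 : ℕ) : ℝ) * t ^ (3 - 1) / 6 = Real.cos t - 1 + t ^ 2 / 2 := by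
        push_cast; ring
      rw [e, one_mul]; exact abs_cos_sub_le_pow t) t
  simpa using this

theorem exists_bound_on_box {n : ℕ} {f : (Fin n → ℝ) → ℝ} (hf : Continuous f) (R : ℝ) :
    ∃ C, 0 ≤ C ∧ ∀ v, (∀ i, |v i| ≤ R) → |f v| ≤ C := by
  obtain ⟨C, hC⟩ := (isCompact_closedBall (0 : Fin n → ℝ) |R|).exists_bound_of_continuousOn
    hf.continuousOn
  refine ⟨|C|, abs_nonneg C, fun v hv => (hC v ?_).trans (le_abs_self C)⟩
  rw [mem_closedBall_zero_iff, pi_norm_le_iff_of_nonneg (abs_nonneg R)]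
  exact fun i => (hv i).trans (le_abs_self R)

/-- The modified energy of a link of an orbit, evaluated at the midpoint of the link: `x` and `w`
are the position and the symmetrized velocity at its initial point. -/
noncomputable def linkEnergy (μ x w : ℝ) : ℝ :=
  (w + μ / 2 * Real.sin x) ^ 2 / 2 + Real.cos (x + μ / 2 * w + μ ^ 2 / 4 * Real.sin x) +
    μ ^ 2 * ((w + μ / 2 * Real.sin x) ^ 2 *
        Real.cos (x + μ / 2 * w + μ ^ 2 / 4 * Real.sin x) / 24 +
      Real.sin (x + μ / 2 * w + μ ^ 2 / 4 * Real.sin x) ^ 2 / 12)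

/-- `linkEnergy (-μ) x w` belongs to the link ending at `x`. The two midpoints are symmetric about
`x + μ² / 4 sin x`, so the addition formulas leave only terms odd in μ. The weights 1/24 and 1/12 of
the correction make the cubic terms cancel as well. -/
theorem linkEnergy_sub_neg (μ x w : ℝ) :
    let s := Real.sin x
    let S := Real.sin (x + μ ^ 2 / 4 * s)
    let C := Real.cos (x + μ ^ 2 / 4 * s)
    let σ := Real.sin (μ / 2 * w)
    let κ := Real.cos (μ / 2 * w)
    linkEnergy μ x w - linkEnergy (-μ) x w = μ * w * s - 2 * S * σ +
      μ ^ 2 / 24 * (-2 * (w ^ 2 + μ ^ 2 * s ^ 2 / 4) * S * σ + 2 * μ * w * s * C * κ) +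
      μ ^ 2 / 12 * ((2 * S * C) * (2 * σ * κ)) := by
  simp only
  set s := Real.sin x
  have e1 : x + μ / 2 * w + μ ^ 2 / 4 * s = (x + μ ^ 2 / 4 * s) + μ / 2 * w := by ring
  have e2 : x + -μ / 2 * w + (-μ) ^ 2 / 4 * s = (x + μ ^ 2 / 4 * s) - μ / 2 * w := by ring
  unfold linkEnergy
  rw [e1, e2]
  generalize x + μ ^ 2 / 4 * s = X
  rw [Real.cos_add, Real.cos_sub, Real.sin_add, Real.sin_sub]
  ring

/-- The modified energy changes by a term of fifth order in one step. -/
theorem exists_linkEnergy_sub_neg_le (B : ℝ) :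
    ∃ C, 0 ≤ C ∧ ∀ μ x w, 0 < μ → μ ≤ 1 → |w| ≤ B →
      |linkEnergy μ x w - linkEnergy (-μ) x w| ≤ C * μ ^ 5 := by
  -- The difference divided by `μ ^ 5`, as a polynomial in `μ, w, s, c` and the rescaled remainders
  -- `r, t, S₄, C₂` introduced below; only its boundedness matters.
  let Q : (Fin 8 → ℝ) → ℝ := fun v =>
      (-2) * v 2 * v 4 + (-1) * v 1 * v 6 + (1 / 4) * v 1 * v 2 * v 7 + (1 / 4) * v 1 * v 2 * v 3
      * v 5 + (1 / 24) * v 1 * v 2 * v 3 ^ 2 + (-1 / 96) * v 1 * v 2 ^ 3 + (-1 / 144) * v 1 ^ 3 *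
      v 2 * v 3 + (1 / 576) * v 1 ^ 5 * v 2 + (-1 / 6) * v 0 ^ 2 * v 2 * v 3 * v 4 + (1 / 6) * v 0
      ^ 2 * v 1 * v 3 * v 6 + (1 / 4) * v 0 ^ 2 * v 1 * v 2 * v 5 * v 7 + (1 / 24) * v 0 ^ 2 * v 1
      * v 2 * v 3 * v 7 + (1 / 24) * v 0 ^ 2 * v 1 * v 2 * v 3 ^ 2 * v 5 + (-1 / 384) * v 0 ^ 2 *
      v 1 * v 2 ^ 3 * v 3 + (-1 / 12) * v 0 ^ 2 * v 1 ^ 2 * v 2 * v 4 + (-1 / 144) * v 0 ^ 2 * v 1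
      ^ 3 * v 2 * v 7 + (-1 / 144) * v 0 ^ 2 * v 1 ^ 3 * v 2 * v 3 * v 5 + (-1 / 576) * v 0 ^ 2 *
      v 1 ^ 3 * v 2 * v 3 ^ 2 + (1 / 2304) * v 0 ^ 2 * v 1 ^ 3 * v 2 ^ 3 + (1 / 2304) * v 0 ^ 2 *
      v 1 ^ 5 * v 2 * v 3 + (-2) * v 0 ^ 4 * v 4 * v 6 + (1 / 3) * v 0 ^ 4 * v 2 * v 4 * v 7 + (1
      / 3) * v 0 ^ 4 * v 2 * v 3 * v 4 * v 5 + (1 / 12) * v 0 ^ 4 * v 2 * v 3 ^ 2 * v 4 + (-1 /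
      48) * v 0 ^ 4 * v 2 ^ 3 * v 4 + (1 / 6) * v 0 ^ 4 * v 1 * v 6 * v 7 + (1 / 6) * v 0 ^ 4 * v
      1 * v 3 * v 5 * v 6 + (1 / 24) * v 0 ^ 4 * v 1 * v 2 * v 3 * v 5 * v 7 + (-1 / 96) * v 0 ^ 4
      * v 1 * v 2 ^ 2 * v 6 + (-1 / 48) * v 0 ^ 4 * v 1 ^ 2 * v 2 * v 3 * v 4 + (-1 / 144) * v 0 ^
      4 * v 1 ^ 3 * v 3 * v 6 + (-1 / 144) * v 0 ^ 4 * v 1 ^ 3 * v 2 * v 5 * v 7 + (-1 / 576) * v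
      0 ^ 4 * v 1 ^ 3 * v 2 * v 3 * v 7 + (-1 / 576) * v 0 ^ 4 * v 1 ^ 3 * v 2 * v 3 ^ 2 * v 5 +
      (1 / 9216) * v 0 ^ 4 * v 1 ^ 3 * v 2 ^ 3 * v 3 + (1 / 576) * v 0 ^ 4 * v 1 ^ 5 * v 6 + (1 /
      3) * v 0 ^ 6 * v 3 * v 4 * v 6 + (1 / 3) * v 0 ^ 6 * v 2 * v 4 * v 5 * v 7 + (1 / 12) * v 0
      ^ 6 * v 2 * v 3 * v 4 * v 7 + (1 / 12) * v 0 ^ 6 * v 2 * v 3 ^ 2 * v 4 * v 5 + (-1 / 192) *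
      v 0 ^ 6 * v 2 ^ 3 * v 3 * v 4 + (1 / 6) * v 0 ^ 6 * v 1 * v 5 * v 6 * v 7 + (-1 / 12) * v 0
      ^ 6 * v 1 ^ 2 * v 4 * v 6 + (-1 / 144) * v 0 ^ 6 * v 1 ^ 3 * v 6 * v 7 + (-1 / 144) * v 0 ^
      6 * v 1 ^ 3 * v 3 * v 5 * v 6 + (-1 / 576) * v 0 ^ 6 * v 1 ^ 3 * v 2 * v 3 * v 5 * v 7 + (1
      / 2304) * v 0 ^ 6 * v 1 ^ 3 * v 2 ^ 2 * v 6 + (1 / 3) * v 0 ^ 8 * v 4 * v 6 * v 7 + (1 / 3)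
      * v 0 ^ 8 * v 3 * v 4 * v 5 * v 6 + (1 / 12) * v 0 ^ 8 * v 2 * v 3 * v 4 * v 5 * v 7 + (-1 /
      48) * v 0 ^ 8 * v 2 ^ 2 * v 4 * v 6 + (-1 / 144) * v 0 ^ 8 * v 1 ^ 3 * v 5 * v 6 * v 7 + (1
      / 3) * v 0 ^ 10 * v 4 * v 5 * v 6 * v 7
  have hQ : Continuous Q := by fun_prop
  obtain ⟨C, hC, hbound⟩ := exists_bound_on_box hQ (4 + |B| ^ 5 + |B| ^ 2 + |B|)
  refine ⟨C, hC, fun μ x w hμ hμ1 hw => ?_⟩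
  set s := Real.sin x with hs
  set c := Real.cos x with hc
  have hs1 : |s| ≤ 1 := Real.abs_sin_le_one x
  have hc1 : |c| ≤ 1 := Real.abs_cos_le_one x
  have hwB : |w| ≤ |B| := hw.trans (le_abs_self B)
  have hB0 := abs_nonneg B
  -- Taylor remainders divided by the power of μ that keeps them bounded.
  set r := (Real.sin (μ / 2 * w) - μ / 2 * w + (μ / 2 * w) ^ 3 / 6) / μ ^ 5 with hr
  set t := (Real.cos (μ / 2 * w) - 1) / μ ^ 2 with ht
  set a := (Real.cos (μ ^ 2 / 4 * s) - 1) / μ ^ 4 with ha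
  set b := (Real.sin (μ ^ 2 / 4 * s) - μ ^ 2 / 4 * s) / μ ^ 4 with hb
  have hr' : Real.sin (μ / 2 * w) = μ / 2 * w - (μ / 2 * w) ^ 3 / 6 + μ ^ 5 * r := by
    rw [hr]; field_simp; ring
  have ht' : Real.cos (μ / 2 * w) = 1 + μ ^ 2 * t := by rw [ht]; field_simp; ring
  have ha' : Real.cos (μ ^ 2 / 4 * s) = 1 + μ ^ 4 * a := by rw [ha]; field_simp; ring
  have hb' : Real.sin (μ ^ 2 / 4 * s) = μ ^ 2 / 4 * s + μ ^ 4 * b := by rw [hb]; field_simp; ring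
  have hr1 : |r| ≤ |B| ^ 5 := by
    rw [hr, abs_div, abs_of_pos (pow_pos hμ 5), div_le_iff₀ (by positivity)]
    refine (abs_sin_sub_le_pow _).trans ?_
    rw [abs_mul, abs_of_pos (half_pos hμ)]
    calc (μ / 2 * |w|) ^ 5 ≤ (μ * |B|) ^ 5 := by gcongr; linarith
      _ = _ := by ring
  have ht1 : |t| ≤ |B| ^ 2 := by
    rw [ht, abs_div, abs_of_pos (pow_pos hμ 2), div_le_iff₀ (by positivity)]
    refine (abs_cos_sub_one_le_sq _).trans ?_
    rw [abs_mul, abs_of_pos (half_pos hμ)]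
    calc (μ / 2 * |w|) ^ 2 ≤ (μ * |B|) ^ 2 := by gcongr; linarith
      _ = _ := by ring
  have hp : |μ ^ 2 / 4 * s| ≤ μ ^ 2 := by
    rw [abs_mul, abs_of_pos (by positivity)]
    nlinarith [sq_nonneg μ]
  have ha1 : |a| ≤ 1 := by
    rw [ha, abs_div, abs_of_pos (pow_pos hμ 4), div_le_iff₀ (by positivity)]
    refine (abs_cos_sub_one_le_sq _).trans ?_
    calc |μ ^ 2 / 4 * s| ^ 2 ≤ (μ ^ 2) ^ 2 := by gcongr
      _ = _ := by ring
  have hb1 : |b| ≤ 1 := by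
    rw [hb, abs_div, abs_of_pos (pow_pos hμ 4), div_le_iff₀ (by positivity)]
    refine (abs_sin_sub_self_le_pow _).trans ?_
    calc |μ ^ 2 / 4 * s| ^ 3 ≤ (μ ^ 2) ^ 3 := by gcongr
      _ = μ ^ 4 * μ ^ 2 := by ring
      _ ≤ μ ^ 4 * 1 := by gcongr; exact pow_le_one₀ hμ.le hμ1
      _ = _ := by ring
  have hμ' : |μ| ≤ 1 := by rwa [abs_of_pos hμ]
  have hprod : ∀ u v : ℝ, |u| ≤ 1 → |v| ≤ 1 → |u * v| ≤ 1 := fun u v hu hv => by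
    rw [abs_mul]; exact mul_le_one₀ hu (abs_nonneg v) hv
  set S₄ := s * a + c * b with hS₄
  set C₂ := c * (μ ^ 2 * a) - s * (s / 4 + μ ^ 2 * b) with hC₂
  have hμ2 : |μ ^ 2| ≤ 1 := by rw [abs_pow]; exact pow_le_one₀ (abs_nonneg _) hμ'
  have hS₄1 : |S₄| ≤ 2 := by
    have := abs_add_le (s * a) (c * b)
    have := hprod s a hs1 ha1
    have := hprod c b hc1 hb1
    linarith
  have hC₂1 : |C₂| ≤ 4 := by
    have h1 := hprod c _ hc1 (hprod _ _ hμ2 ha1)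
    have h2 := abs_le.1 (hprod s s hs1 hs1)
    have h3 := hprod s _ hs1 (hprod _ _ hμ2 hb1)
    have e : C₂ = c * (μ ^ 2 * a) - s * s / 4 - s * (μ ^ 2 * b) := by rw [hC₂]; ring
    rw [e]
    have h1' := abs_le.1 h1
    have h3' := abs_le.1 h3
    rw [abs_le]
    constructor <;> linarith [h1'.1, h1'.2, h2.1, h2.2, h3'.1, h3'.2]
  have hS : Real.sin (x + μ ^ 2 / 4 * s) = s + μ ^ 2 * (c * s / 4) + μ ^ 4 * S₄ := by
    rw [Real.sin_add, ha', hb', hS₄]; ring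
  have hCc : Real.cos (x + μ ^ 2 / 4 * s) = c + μ ^ 2 * C₂ := by
    rw [Real.cos_add, ha', hb', hC₂]; ring
  have key : linkEnergy μ x w - linkEnergy (-μ) x w =
      μ ^ 5 * Q ![μ, w, s, c, r, t, S₄, C₂] := by
    have := linkEnergy_sub_neg μ x w
    simp only at this
    rw [this, hS, hCc, hr', ht']
    simp only [Q, Matrix.cons_val]
    ring
  rw [key, abs_mul, abs_of_pos (pow_pos hμ 5), mul_comm]
  have q5 : 0 ≤ |B| ^ 5 := by positivity
  have q2 : 0 ≤ |B| ^ 2 := by positivity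
  refine mul_le_mul_of_nonneg_right (hbound _ fun i => ?_) (pow_pos hμ 5).le
  fin_cases i
  · change |μ| ≤ _; linarith
  · change |w| ≤ _; linarith
  · change |s| ≤ _; linarith
  · change |c| ≤ _; linarith
  · change |r| ≤ _; linarith
  · change |t| ≤ _; linarith
  · change |S₄| ≤ _; linarith
  · change |C₂| ≤ _; linarith

/-- The modified energy is the energy up to terms of second order. -/
theorem exists_linkEnergy_sub_pendulumEnergy_le (B : ℝ) :
    ∃ C, 0 ≤ C ∧ ∀ μ x w, 0 < μ → μ ≤ 1 → |w| ≤ B →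
      |linkEnergy μ x w - pendulumEnergy x w| ≤ C * μ ^ 2 := by
  set b := |B| + 1 with hb
  have hb0 : 0 ≤ b := by positivity
  refine ⟨1 / 8 + b ^ 2 + b ^ 3 + (b ^ 2 / 24 + 1 / 12), by positivity, fun μ x w hμ hμ1 hw => ?_⟩
  set s := Real.sin x with hs
  set c := Real.cos x with hc
  have hs1 : |s| ≤ 1 := Real.abs_sin_le_one x
  have hc1 : |c| ≤ 1 := Real.abs_cos_le_one x
  have hwB : |w| ≤ |B| := hw.trans (le_abs_self B)
  set δ := μ / 2 * w + μ ^ 2 / 4 * s with hδ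
  set z := w + μ / 2 * s with hz
  have hzb : |z| ≤ b := by
    have h1 := abs_add_le w (μ / 2 * s)
    have h2 : |μ / 2 * s| ≤ 1 * 1 := by
      rw [abs_mul, abs_of_pos (half_pos hμ)]
      gcongr
      linarith
    linarith
  have hδb : |δ| ≤ μ * b := by
    have e : δ = μ / 2 * z := by rw [hδ, hz]; ring
    rw [e, abs_mul, abs_of_pos (half_pos hμ)]
    gcongr
    linarith
  -- The first-order terms `± μ w s / 2`, from the square and from the cosine, cancel.
  have e1 : linkEnergy μ x w - pendulumEnergy x w =
      -(μ ^ 2 * (s ^ 2 / 8)) + c * (Real.cos δ - 1) - s * (Real.sin δ - δ) +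
        μ ^ 2 * (z ^ 2 * Real.cos (x + δ) / 24 + Real.sin (x + δ) ^ 2 / 12) := by
    unfold linkEnergy pendulumEnergy
    rw [show x + μ / 2 * w + μ ^ 2 / 4 * Real.sin x = x + δ by rw [hδ]; ring]
    have := Real.cos_add x δ
    linear_combination this
  have t1 : |μ ^ 2 * (s ^ 2 / 8)| ≤ μ ^ 2 * (1 / 8) := by
    rw [abs_mul, abs_of_pos (by positivity : 0 < μ ^ 2), abs_of_nonneg (by positivity)]
    have : s ^ 2 ≤ 1 := (sq_le_one_iff_abs_le_one s).2 hs1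
    gcongr
  have t2 : |c * (Real.cos δ - 1)| ≤ μ ^ 2 * b ^ 2 := by
    rw [abs_mul]
    calc |c| * |Real.cos δ - 1| ≤ 1 * |δ| ^ 2 := by gcongr; exact abs_cos_sub_one_le_sq δ
      _ ≤ 1 * (μ * b) ^ 2 := by gcongr
      _ = _ := by ring
  have t3 : |s * (Real.sin δ - δ)| ≤ μ ^ 2 * b ^ 3 := by
    rw [abs_mul]
    calc |s| * |Real.sin δ - δ| ≤ 1 * |δ| ^ 3 := by gcongr; exact abs_sin_sub_self_le_pow δ
      _ ≤ 1 * (μ * b) ^ 3 := by gcongr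
      _ = μ ^ 2 * b ^ 3 * μ := by ring
      _ ≤ μ ^ 2 * b ^ 3 * 1 := by gcongr
      _ = _ := by ring
  have t4 : |μ ^ 2 * (z ^ 2 * Real.cos (x + δ) / 24 + Real.sin (x + δ) ^ 2 / 12)| ≤
      μ ^ 2 * (b ^ 2 / 24 + 1 / 12) := by
    rw [abs_mul, abs_of_pos (by positivity : 0 < μ ^ 2)]
    have h1 : |z ^ 2 * Real.cos (x + δ)| ≤ b ^ 2 * 1 := by
      rw [abs_mul, abs_pow]
      gcongr
      exact Real.abs_cos_le_one _
    have h2 := Real.sin_sq_le_one (x + δ)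
    have h3 := sq_nonneg (Real.sin (x + δ))
    have h4 := abs_le.1 h1
    refine mul_le_mul_of_nonneg_left (abs_le.2 ⟨?_, ?_⟩) (by positivity) <;> linarith [h4.1, h4.2]
  have t1' := abs_le.1 t1
  have t2' := abs_le.1 t2
  have t3' := abs_le.1 t3
  have t4' := abs_le.1 t4
  rw [e1, abs_le]
  constructor <;> linarith [t1'.1, t1'.2, t2'.1, t2'.2, t3'.1, t3'.2, t4'.1, t4'.2]

end LinkEnergy

/-! ### The time coordinate and the frequency of the rotating pendulum -/

section PendulumTime

/-- The speed of the pendulum of energy `h` at the angle `x`. -/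
noncomputable def pendulumSpeed (h x : ℝ) : ℝ := √(2 * (h - Real.cos x))

/-- The time that the rotating pendulum of energy `h` takes from the angle `0` to the angle `x`. -/
noncomputable def pendulumTime (h x : ℝ) : ℝ := ∫ s in (0 : ℝ)..x, (pendulumSpeed h s)⁻¹

variable {h : ℝ}

theorem pendulumSpeed_sq (hh : 1 < h) (x : ℝ) :
    pendulumSpeed h x ^ 2 = 2 * (h - Real.cos x) := by
  rw [pendulumSpeed, Real.sq_sqrt]
  have := Real.cos_le_one x
  linarith

theorem sqrt_le_pendulumSpeed (h x : ℝ) : √(2 * (h - 1)) ≤ pendulumSpeed h x := by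
  apply Real.sqrt_le_sqrt
  have := Real.cos_le_one x
  linarith

theorem pendulumSpeed_le_sqrt (h x : ℝ) : pendulumSpeed h x ≤ √(2 * (h + 1)) := by
  apply Real.sqrt_le_sqrt
  have := Real.neg_one_le_cos x
  linarith

theorem sqrt_speed_pos (hh : 1 < h) : 0 < √(2 * (h - 1)) := Real.sqrt_pos.2 (by linarith)

theorem pendulumSpeed_pos (hh : 1 < h) (x : ℝ) : 0 < pendulumSpeed h x :=
  (sqrt_speed_pos hh).trans_le (sqrt_le_pendulumSpeed h x)

theorem hasDerivAt_pendulumSpeed (hh : 1 < h) (x : ℝ) :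
    HasDerivAt (pendulumSpeed h) (Real.sin x / pendulumSpeed h x) x := by
  have h1 : HasDerivAt (fun x => 2 * (h - Real.cos x)) (2 * Real.sin x) x := by
    simpa using ((Real.hasDerivAt_cos x).const_sub h).const_mul 2
  have hne : 2 * (h - Real.cos x) ≠ 0 := by
    have := Real.cos_le_one x
    linarith
  have := h1.sqrt hne
  refine this.congr_deriv ?_
  rw [show pendulumSpeed h x = √(2 * (h - Real.cos x)) from rfl]
  field_simp

theorem continuous_pendulumSpeed_inv (hh : 1 < h) : Continuous fun s => (pendulumSpeed h s)⁻¹ := by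
  refine Continuous.inv₀ ?_ fun x => (pendulumSpeed_pos hh x).ne'
  unfold pendulumSpeed
  fun_prop

theorem hasDerivAt_pendulumTime (hh : 1 < h) (x : ℝ) :
    HasDerivAt (pendulumTime h) (pendulumSpeed h x)⁻¹ x :=
  (continuous_pendulumSpeed_inv hh).integral_hasStrictDerivAt 0 x |>.hasDerivAt

/-- The third derivative is bounded uniformly, because above the saddle energy the speed is bounded
away from zero; three integrations give the remainder. -/
theorem exists_pendulumTime_taylor (hh : 1 < h) :
    ∃ M, 0 ≤ M ∧ ∀ x d, |pendulumTime h (x + d) - pendulumTime h x - (pendulumSpeed h x)⁻¹ * d +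
      Real.sin x / pendulumSpeed h x ^ 3 * (d ^ 2 / 2)| ≤ M * |d| ^ 3 := by
  set w₀ := √(2 * (h - 1)) with hw₀
  have hw₀p : 0 < w₀ := sqrt_speed_pos hh
  set W := pendulumSpeed h with hW
  have hWp : ∀ x, 0 < W x := pendulumSpeed_pos hh
  have hWw : ∀ x, w₀ ≤ W x := sqrt_le_pendulumSpeed h
  have hWd : ∀ x, HasDerivAt W (Real.sin x / W x) x := hasDerivAt_pendulumSpeed hh
  have d1 : ∀ x, HasDerivAt (fun x => (W x)⁻¹) (-(Real.sin x / W x ^ 3)) x := fun x => by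
    refine ((hWd x).inv (hWp x).ne').congr_deriv ?_
    have := (hWp x).ne'
    field_simp
  have d2 : ∀ x, HasDerivAt (fun x => -(Real.sin x / W x ^ 3))
      (-(Real.cos x / W x ^ 3) + 3 * Real.sin x ^ 2 / W x ^ 5) x := fun x => by
    have hne := (hWp x).ne'
    refine (((Real.hasDerivAt_sin x).div ((hWd x).pow 3) (pow_ne_zero 3 hne)).neg).congr_deriv ?_
    simp only [Pi.pow_apply]
    field_simp
    ring
  set M := 1 / w₀ ^ 3 + 3 / w₀ ^ 5 with hM
  have bound : ∀ x, |-(Real.cos x / W x ^ 3) + 3 * Real.sin x ^ 2 / W x ^ 5| ≤ M := fun x => by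
    refine (abs_add_le _ _).trans (add_le_add ?_ ?_)
    · rw [abs_neg, abs_div, abs_of_pos (pow_pos (hWp x) 3)]
      gcongr
      · exact Real.abs_cos_le_one x
      · exact hWw x
    · have hs := Real.sin_sq_le_one x
      have := hWp x
      rw [abs_of_nonneg (by positivity)]
      gcongr
      · linarith
      · exact hWw x
  refine ⟨M, by positivity, fun x d => ?_⟩
  have s1 : ∀ d, |-(Real.sin (x + d) / W (x + d) ^ 3) + Real.sin x / W x ^ 3| ≤ M * |d| ^ 1 :=
    abs_le_mul_pow_of_hasDerivAt (k := 0)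
      (fun t => ((d2 (x + t)).comp_const_add x t).add_const _) (by simp)
      (fun t => by simpa using bound (x + t))
  have s2 : ∀ d, |(W (x + d))⁻¹ - (W x)⁻¹ + Real.sin x / W x ^ 3 * d| ≤ M * |d| ^ 2 :=
    abs_le_mul_pow_of_hasDerivAt (k := 1)
      (fun t => (((d1 (x + t)).comp_const_add x t).sub_const _).add
        ((hasDerivAt_id t).const_mul _)) (by simp)
      (fun t => by simpa using s1 t)
  exact abs_le_mul_pow_of_hasDerivAt (k := 2)
    (g := fun d => pendulumTime h (x + d) - pendulumTime h x - (W x)⁻¹ * d +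
      Real.sin x / W x ^ 3 * (d ^ 2 / 2))
    (fun t => ((((hasDerivAt_pendulumTime hh (x + t)).comp_const_add x t).sub_const _).sub
        ((hasDerivAt_id t).const_mul _)).add (((hasDerivAt_pow 2 t).div_const 2).const_mul _))
    (by simp)
    (fun t => by simpa using s2 t) d

/-- In one step of the symmetrized standard map the pendulum time advances by the step size up to
terms of third order. -/
theorem exists_pendulumTime_step (hh : 1 < h) {A : ℝ} (hA : 0 ≤ A) :
    ∃ C, 0 ≤ C ∧ ∀ μ x w, 0 < μ → μ ≤ 1 → |w - pendulumSpeed h x| ≤ A * μ ^ 2 →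
      |pendulumTime h (x + μ * w + μ ^ 2 / 2 * Real.sin x) - pendulumTime h x - μ| ≤
        C * μ ^ 3 := by
  obtain ⟨M, hM, hT⟩ := exists_pendulumTime_taylor hh
  set w₀ := √(2 * (h - 1)) with hw₀
  have hw₀p : 0 < w₀ := sqrt_speed_pos hh
  set W₁ := √(2 * (h + 1)) with hW₁
  have hW₁p : 0 ≤ W₁ := Real.sqrt_nonneg _
  refine ⟨M * (W₁ + A + 1) ^ 3 + (A / w₀ + (2 * W₁ * (A + 1) + (A + 1) ^ 2) / (2 * w₀ ^ 3)),
    by positivity, fun μ x w hμ hμ1 hw => ?_⟩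
  set W := pendulumSpeed h x with hW
  have hWp : 0 < W := pendulumSpeed_pos hh x
  have hWw : w₀ ≤ W := sqrt_le_pendulumSpeed h x
  have hWW : W ≤ W₁ := pendulumSpeed_le_sqrt h x
  set s := Real.sin x with hs
  have hs1 : |s| ≤ 1 := Real.abs_sin_le_one x
  set e := w - W with he
  set k := μ * e + μ ^ 2 / 2 * s with hk
  have hμ2 : μ ^ 2 ≤ μ := by nlinarith
  have hμ21 : μ ^ 2 ≤ 1 := hμ2.trans hμ1
  have hk1 : |k| ≤ (A + 1) * μ ^ 2 := by
    have h1 : |μ * e| ≤ A * μ ^ 2 := by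
      rw [abs_mul, abs_of_pos hμ]
      calc μ * |e| ≤ 1 * (A * μ ^ 2) := by gcongr
        _ = _ := one_mul _
    have h2 : |μ ^ 2 / 2 * s| ≤ μ ^ 2 := by
      rw [abs_mul, abs_of_pos (by positivity)]
      calc μ ^ 2 / 2 * |s| ≤ μ ^ 2 / 2 * 1 := by gcongr
        _ ≤ μ ^ 2 := by linarith [sq_nonneg μ]
    have := abs_add_le (μ * e) (μ ^ 2 / 2 * s)
    linarith
  have hd : x + μ * w + μ ^ 2 / 2 * s = x + (μ * W + k) := by rw [hk, he]; ring
  have hd1 : |μ * W + k| ≤ μ * (W₁ + A + 1) := by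
    have h1 : |μ * W| ≤ μ * W₁ := by
      rw [abs_of_pos (by positivity)]; gcongr
    have h2 : (A + 1) * μ ^ 2 ≤ (A + 1) * μ := by gcongr
    have := abs_add_le (μ * W) k
    linarith
  have t1 := hT x (μ * W + k)
  have t1' : M * |μ * W + k| ^ 3 ≤ M * (W₁ + A + 1) ^ 3 * μ ^ 3 := by
    calc M * |μ * W + k| ^ 3 ≤ M * (μ * (W₁ + A + 1)) ^ 3 := by gcongr
      _ = _ := by ring
  -- The acceleration part `μ² s / 2` of `k` cancels the quadratic Taylor term at `μ W`, so no
  -- second-order term survives.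
  have e2 : W⁻¹ * (μ * W + k) - s / W ^ 3 * ((μ * W + k) ^ 2 / 2) - μ =
      μ * e / W - s * (2 * μ * W * k + k ^ 2) / (2 * W ^ 3) := by
    rw [hk]
    field_simp
    ring
  have t2 : |μ * e / W| ≤ A / w₀ * μ ^ 3 := by
    rw [abs_div, abs_mul, abs_of_pos hμ, abs_of_pos hWp]
    calc μ * |e| / W ≤ μ * (A * μ ^ 2) / w₀ := by gcongr
      _ = _ := by ring
  have t3 : |s * (2 * μ * W * k + k ^ 2) / (2 * W ^ 3)| ≤
      (2 * W₁ * (A + 1) + (A + 1) ^ 2) / (2 * w₀ ^ 3) * μ ^ 3 := by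
    have h1 : |2 * μ * W * k + k ^ 2| ≤ (2 * W₁ * (A + 1) + (A + 1) ^ 2) * μ ^ 3 := by
      have h3 : |2 * μ * W * k| ≤ 2 * W₁ * (A + 1) * μ ^ 3 := by
        rw [abs_mul, abs_of_pos (by positivity)]
        calc 2 * μ * W * |k| ≤ 2 * μ * W₁ * ((A + 1) * μ ^ 2) := by gcongr
          _ = _ := by ring
      have h4 : |k ^ 2| ≤ (A + 1) ^ 2 * μ ^ 3 := by
        rw [abs_pow]
        calc |k| ^ 2 ≤ ((A + 1) * μ ^ 2) ^ 2 := by gcongr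
          _ = (A + 1) ^ 2 * μ ^ 3 * μ := by ring
          _ ≤ (A + 1) ^ 2 * μ ^ 3 * 1 := by gcongr
          _ = _ := mul_one _
      have := abs_add_le (2 * μ * W * k) (k ^ 2)
      linarith
    rw [abs_div, abs_mul, abs_of_pos (by positivity : 0 < 2 * W ^ 3)]
    calc |s| * |2 * μ * W * k + k ^ 2| / (2 * W ^ 3)
        ≤ 1 * ((2 * W₁ * (A + 1) + (A + 1) ^ 2) * μ ^ 3) / (2 * w₀ ^ 3) := by gcongr
      _ = _ := by ring
  rw [hd]
  have a1 := abs_le.1 (t1.trans t1')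
  have a2 := abs_le.1 t2
  have a3 := abs_le.1 t3
  rw [abs_le]
  constructor <;> linarith [a1.1, a1.2, a2.1, a2.2, a3.1, a3.2]

/-- The period of the pendulum of energy `h`. -/
noncomputable def pendulumPeriod (h : ℝ) : ℝ := pendulumTime h (2 * Real.pi)

theorem pendulumPeriod_pos (hh : 1 < h) : 0 < pendulumPeriod h :=
  intervalIntegral.intervalIntegral_pos_of_pos
    ((continuous_pendulumSpeed_inv hh).intervalIntegrable _ _)
    (fun x => inv_pos.2 (pendulumSpeed_pos hh x)) Real.two_pi_pos

theorem pendulumTime_add_two_pi (hh : 1 < h) (x : ℝ) :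
    pendulumTime h (x + 2 * Real.pi) = pendulumTime h x + pendulumPeriod h := by
  have hd : ∀ t, HasDerivAt (fun t => pendulumTime h (t + 2 * Real.pi) - pendulumTime h t) 0 t := by
    intro t
    have := ((hasDerivAt_pendulumTime hh (t + 2 * Real.pi)).comp_add_const t (2 * Real.pi)).sub
      (hasDerivAt_pendulumTime hh t)
    refine this.congr_deriv ?_
    simp [pendulumSpeed]
  have := is_const_of_deriv_eq_zero (fun t => (hd t).differentiableAt) (fun t => (hd t).deriv) x 0
  simp only [zero_add] at this
  have h0 : pendulumTime h 0 = 0 := intervalIntegral.integral_same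
  rw [h0, sub_zero] at this
  rw [pendulumPeriod]
  linarith

/-- The pendulum time is a bounded perturbation of a linear function. -/
theorem exists_pendulumTime_linear (hh : 1 < h) :
    ∃ c, 0 ≤ c ∧ ∀ x y, |2 * Real.pi / pendulumPeriod h * (pendulumTime h x - pendulumTime h y) -
      (x - y)| ≤ c := by
  have hP := pendulumPeriod_pos hh
  set G : ℝ → ℝ := fun x => 2 * Real.pi / pendulumPeriod h * pendulumTime h x - x with hG
  have hper : Function.Periodic G (2 * Real.pi) := fun x => by
    simp only [hG, pendulumTime_add_two_pi hh]
    field_simp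
    ring
  have hcont : Continuous G := by
    have : Continuous (pendulumTime h) :=
      continuous_iff_continuousAt.2 fun x => (hasDerivAt_pendulumTime hh x).continuousAt
    fun_prop
  obtain ⟨c, hc⟩ := (isCompact_Icc (a := (0 : ℝ)) (b := 2 * Real.pi)).exists_bound_of_continuousOn
    hcont.continuousOn
  have hbd : ∀ x, |G x| ≤ c := fun x => by
    obtain ⟨y, hy, he⟩ := hper.exists_mem_Ico₀ Real.two_pi_pos x
    rw [he]
    exact hc y (Set.Ico_subset_Icc_self hy)
  refine ⟨2 * c, by linarith [(abs_nonneg _).trans (hbd 0)], fun x y => ?_⟩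
  have e : 2 * Real.pi / pendulumPeriod h * (pendulumTime h x - pendulumTime h y) - (x - y)
      = G x - G y := by simp only [hG]; ring
  rw [e]
  have := abs_sub (G x) (G y)
  linarith [hbd x, hbd y]

theorem IsPendulumOrbit.energy_eq {X Z : ℝ → ℝ} (hXZ : IsPendulumOrbit X Z) (t : ℝ) :
    pendulumEnergy (X t) (Z t) = pendulumEnergy (X 0) (Z 0) := by
  have hd : ∀ t, HasDerivAt (fun t => pendulumEnergy (X t) (Z t)) 0 t := by
    intro t
    have := (((hXZ t).2.pow 2).div_const 2).add ((hXZ t).1.cos)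
    refine this.congr_deriv ?_
    simp
    ring
  exact is_const_of_deriv_eq_zero (fun t => (hd t).differentiableAt) (fun t => (hd t).deriv) t 0

/-- Above the saddle energy the velocity never vanishes, so it equals `pendulumSpeed` and the time
coordinate along the orbit is the time itself. The angle is linear in it up to a bounded error. -/
theorem IsPendulumOrbit.hasFrequency_of_pos {X Z : ℝ → ℝ} (hh : 1 < h) (hXZ : IsPendulumOrbit X Z)
    (hE : pendulumEnergy (X 0) (Z 0) = h) (hZ : 0 < Z 0) : HasFrequency X (pendulumPeriod h)⁻¹ := by
  have hsq : ∀ t, Z t ^ 2 = 2 * (h - Real.cos (X t)) := fun t => by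
    have := hXZ.energy_eq t
    rw [hE, pendulumEnergy] at this
    linarith
  have hZc : Continuous Z := continuous_iff_continuousAt.2 fun t => (hXZ t).2.continuousAt
  have hZne : ∀ t, Z t ≠ 0 := fun t ht => by
    have := hsq t
    rw [ht] at this
    have := Real.cos_le_one (X t)
    linarith
  have hZpos : ∀ t, 0 < Z t := fun t => by
    by_contra! hle
    obtain ⟨r, hr⟩ := mem_range_of_exists_le_of_exists_ge hZc ⟨t, hle⟩ ⟨0, hZ.le⟩
    exact hZne r hr
  have hZW : ∀ t, Z t = pendulumSpeed h (X t) := fun t => by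
    rw [pendulumSpeed, ← hsq t, Real.sqrt_sq (hZpos t).le]
  have hT : ∀ t, pendulumTime h (X t) - pendulumTime h (X 0) = t := by
    have hd : ∀ t, HasDerivAt (fun t => pendulumTime h (X t) - t) 0 t := fun t => by
      have := ((hasDerivAt_pendulumTime hh (X t)).comp t (hXZ t).1).sub (hasDerivAt_id t)
      refine this.congr_deriv ?_
      rw [hZW t, inv_mul_cancel₀ (pendulumSpeed_pos hh _).ne', sub_self]
    intro t
    have := is_const_of_deriv_eq_zero (fun t => (hd t).differentiableAt) (fun t => (hd t).deriv) t 0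
    linarith
  obtain ⟨c, hc0, hc⟩ := exists_pendulumTime_linear hh
  have hP := pendulumPeriod_pos hh
  unfold HasFrequency
  rw [tendsto_iff_dist_tendsto_zero]
  refine squeeze_zero' (Eventually.of_forall fun _ => dist_nonneg) ?_
    ((tendsto_const_nhds (x := c)).div_atTop tendsto_id)
  filter_upwards [eventually_gt_atTop 0] with t ht
  have := hc (X t) (X 0)
  rw [hT t] at this
  have e : (X t - X 0) / t - 2 * Real.pi * (pendulumPeriod h)⁻¹ =
      -(2 * Real.pi / pendulumPeriod h * t - (X t - X 0)) / t := by
    field_simp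
    ring
  rw [Real.dist_eq, e, abs_div, abs_neg, abs_of_pos ht, id]
  gcongr

end PendulumTime

/-! ### Energy and angle along orbits for times of order `μ⁻³` -/

section VerletOrbit

/-- An orbit of the standard map in the coordinates `x` and `w = z + (μ / 2) sin x`, `y = μ z`. -/
structure IsVerletOrbit (μ : ℝ) (x w : ℕ → ℝ) : Prop where
  x_succ : ∀ n, x (n + 1) = x n + μ * w n + μ ^ 2 / 2 * Real.sin (x n)
  w_succ : ∀ n, w (n + 1) = w n + μ / 2 * (Real.sin (x n) + Real.sin (x (n + 1)))

variable {μ : ℝ} {x w : ℕ → ℝ}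

theorem IsVerletOrbit.neg (h : IsVerletOrbit μ x w) :
    IsVerletOrbit μ (fun n => -x n) (fun n => -w n) := by
  constructor <;> intro n
  · rw [h.x_succ, Real.sin_neg]; ring
  · rw [h.w_succ, Real.sin_neg, Real.sin_neg]; ring

/-- Consecutive links of an orbit share the midpoint between them. -/
theorem IsVerletOrbit.linkEnergy_succ (h : IsVerletOrbit μ x w) (n : ℕ) :
    linkEnergy (-μ) (x (n + 1)) (w (n + 1)) = linkEnergy μ (x n) (w n) := by
  have e1 : w (n + 1) + -μ / 2 * Real.sin (x (n + 1)) = w n + μ / 2 * Real.sin (x n) := by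
    rw [h.w_succ]; ring
  have e2 : x (n + 1) + -μ / 2 * w (n + 1) + (-μ) ^ 2 / 4 * Real.sin (x (n + 1)) =
      x n + μ / 2 * w n + μ ^ 2 / 4 * Real.sin (x n) := by
    rw [h.w_succ]
    have := h.x_succ n
    linear_combination this
  unfold linkEnergy
  rw [e1, e2]
  ring

theorem abs_le_of_pendulumEnergy_le {h x w : ℝ} (hE : |pendulumEnergy x w - h| ≤ 1) :
    |w| ≤ √(2 * (h + 2)) := by
  apply Real.abs_le_sqrt
  have h1 := (abs_le.1 hE).2
  have h2 := Real.neg_one_le_cos x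
  rw [pendulumEnergy] at h1
  linarith

/-- The product `(w - W) (w + W)` is twice the energy error, and `w + W` is at least the minimal
speed. -/
theorem abs_sub_pendulumSpeed_le {h x w δ : ℝ} (hh : 1 < h) (hw : 0 ≤ w)
    (hE : |pendulumEnergy x w - h| ≤ δ) : |w - pendulumSpeed h x| ≤ 2 / √(2 * (h - 1)) * δ := by
  have hp := sqrt_speed_pos hh
  have hW := sqrt_le_pendulumSpeed h x
  have hsq := pendulumSpeed_sq hh x
  set W := pendulumSpeed h x
  have e : (w - W) * (w + W) = 2 * (pendulumEnergy x w - h) := by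
    rw [pendulumEnergy]; linear_combination -hsq
  have h1 : |w - W| * √(2 * (h - 1)) ≤ 2 * δ := by
    calc |w - W| * √(2 * (h - 1)) ≤ |w - W| * |w + W| := by
          gcongr
          rw [abs_of_nonneg (by linarith)]
          linarith
      _ = 2 * |pendulumEnergy x w - h| := by
          rw [← abs_mul, e, abs_mul, abs_of_pos (two_pos : (0 : ℝ) < 2)]
      _ ≤ _ := by gcongr
  rw [div_mul_eq_mul_div, le_div_iff₀ hp]
  exact h1

/-- The energy of an orbit stays close to its initial value for a time of order `μ⁻³`. -/
theorem exists_energy_le {h : ℝ} (hh : 1 < h) {K : ℝ} (hK : 0 ≤ K) :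
    ∃ K₁, 0 ≤ K₁ ∧ ∃ μ₀, 0 < μ₀ ∧ μ₀ ≤ 1 ∧ ∀ μ x w, 0 < μ → μ < μ₀ → IsVerletOrbit μ x w →
      0 < w 0 → |pendulumEnergy (x 0) (w 0) - h| ≤ K * μ ^ 2 →
      ∀ n : ℕ, n * μ ^ 3 ≤ 2 → 0 < w n ∧ |pendulumEnergy (x n) (w n) - h| ≤ K₁ * μ ^ 2 := by
  -- The extra 1 covers one further step, taken before the energy at the new point is controlled.
  set B := √(2 * (h + 2)) + 1 with hB
  obtain ⟨C₅, hC₅, h5⟩ := exists_linkEnergy_sub_neg_le B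
  obtain ⟨C₂, hC₂, h2⟩ := exists_linkEnergy_sub_pendulumEnergy_le B
  -- The initial error, the passage to the link energy and back, and a drift of `C₅ μ⁵` over at most
  -- `2 μ⁻³` steps.
  set K₁ := K + 2 * C₂ + 2 * C₅ with hK₁
  have hK₁0 : 0 ≤ K₁ := by positivity
  -- An energy error at most 1 bounds `w`; at most `(h - 1) / 2` it keeps `w² ≥ h - 1`; and `μ₀ < h
  -- - 1` prevents a step from changing the sign of `w`.
  obtain ⟨μ₀, hμ₀, hμ₀1, hμ₀K, hμ₀h⟩ : ∃ μ₀ : ℝ, 0 < μ₀ ∧ μ₀ ≤ 1 ∧ K₁ * μ₀ ≤ min 1 ((h - 1) / 2) ∧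
      μ₀ < h - 1 := by
    have hm : 0 < min 1 ((h - 1) / 2) := lt_min one_pos (by linarith)
    refine ⟨min 1 ((h - 1) / 2) / (K₁ + 1), by positivity, ?_, ?_, ?_⟩
    · rw [div_le_one (by positivity)]
      linarith [min_le_left 1 ((h - 1) / 2)]
    · rw [mul_div_assoc', div_le_iff₀ (by positivity)]
      nlinarith
    · rw [div_lt_iff₀ (by positivity)]
      have := min_le_right 1 ((h - 1) / 2)
      nlinarith
  refine ⟨K₁, hK₁0, μ₀, hμ₀, hμ₀1, fun μ x w hμ hμlt hvo hw0 hE0 => ?_⟩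
  have hμ1 : μ ≤ 1 := hμlt.le.trans hμ₀1
  have hμ2 : μ ^ 2 ≤ μ := by nlinarith
  have hKμ : K₁ * μ ^ 2 ≤ min 1 ((h - 1) / 2) := by
    refine le_trans ?_ hμ₀K
    gcongr
    linarith
  have hKμ1 : K₁ * μ ^ 2 ≤ 1 := hKμ.trans (min_le_left _ _)
  have hKμh : K₁ * μ ^ 2 ≤ (h - 1) / 2 := hKμ.trans (min_le_right _ _)
  have hwB : ∀ n, |pendulumEnergy (x n) (w n) - h| ≤ K₁ * μ ^ 2 → |w n| ≤ B - 1 := fun n hn => by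
    have := abs_le_of_pendulumEnergy_le (hn.trans hKμ1)
    rw [hB]; linarith
  have hwsq : ∀ n, |pendulumEnergy (x n) (w n) - h| ≤ K₁ * μ ^ 2 → h - 1 ≤ w n ^ 2 := fun n hn => by
    have h1 := (abs_le.1 (hn.trans hKμh)).1
    have h2 := Real.cos_le_one (x n)
    rw [pendulumEnergy] at h1
    linarith
  have hstep : ∀ n, |w (n + 1) - w n| ≤ μ := fun n => by
    rw [hvo.w_succ, add_sub_cancel_left, abs_mul, abs_of_pos (half_pos hμ)]
    have h1 := abs_add_le (Real.sin (x n)) (Real.sin (x (n + 1)))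
    have h2 := Real.abs_sin_le_one (x n)
    have h3 := Real.abs_sin_le_one (x (n + 1))
    nlinarith
  -- Only the link energy accumulates error; the pendulum energy is recovered from it afresh at each
  -- step.
  have main : ∀ n : ℕ, n * μ ^ 3 ≤ 2 → 0 < w n ∧ |pendulumEnergy (x n) (w n) - h| ≤ K₁ * μ ^ 2 ∧
      |linkEnergy μ (x n) (w n) - h| ≤ (K + C₂) * μ ^ 2 + n * μ ^ 3 * (C₅ * μ ^ 2) := by
    intro n
    induction n with
    | zero =>
      intro _
      have hE : |pendulumEnergy (x 0) (w 0) - h| ≤ K₁ * μ ^ 2 := by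
        refine hE0.trans ?_
        gcongr
        linarith
      have h3 := h2 μ (x 0) (w 0) hμ hμ1 (by linarith [hwB 0 hE])
      refine ⟨hw0, hE, ?_⟩
      have := abs_sub_le (linkEnergy μ (x 0) (w 0)) (pendulumEnergy (x 0) (w 0)) h
      simp only [Nat.cast_zero, zero_mul, add_zero]
      linarith
    | succ n ih =>
      intro hn
      have hμ3 : 0 < μ ^ 3 := by positivity
      push_cast at hn ⊢
      obtain ⟨hwn, hEn, hLn⟩ := ih (by linarith)
      have hwB' : |w (n + 1)| ≤ B := by
        have := abs_sub_abs_le_abs_sub (w (n + 1)) (w n)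
        linarith [hwB n hEn, hstep n]
      have a1 := h5 μ (x (n + 1)) (w (n + 1)) hμ hμ1 hwB'
      rw [hvo.linkEnergy_succ] at a1
      have a2 := h2 μ (x (n + 1)) (w (n + 1)) hμ hμ1 hwB'
      have hL : |linkEnergy μ (x (n + 1)) (w (n + 1)) - h| ≤
          (K + C₂) * μ ^ 2 + (n + 1) * μ ^ 3 * (C₅ * μ ^ 2) := by
        have := abs_sub_le (linkEnergy μ (x (n + 1)) (w (n + 1))) (linkEnergy μ (x n) (w n)) h
        linarith
      have hE : |pendulumEnergy (x (n + 1)) (w (n + 1)) - h| ≤ K₁ * μ ^ 2 := by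
        have b1 := abs_sub_le (pendulumEnergy (x (n + 1)) (w (n + 1)))
          (linkEnergy μ (x (n + 1)) (w (n + 1))) h
        rw [abs_sub_comm] at a2
        have b2 : (n + 1) * μ ^ 3 * (C₅ * μ ^ 2) ≤ 2 * (C₅ * μ ^ 2) := by gcongr
        rw [hK₁]
        linarith
      refine ⟨?_, hE, hL⟩
      -- A change of sign in a step of length at most μ would give `w n ≤ μ`, against `w n ^ 2 ≥ h -
      -- 1 > μ ^ 2`.
      by_contra! hle
      have c1 := (abs_le.1 (hstep n)).1
      have c2 : w n ≤ μ := by linarith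
      have c3 := hwsq n hEn
      have c4 : w n ^ 2 ≤ μ ^ 2 := by gcongr
      linarith
  exact fun n hn => ⟨(main n hn).1, (main n hn).2.1⟩

/-- The angle along an orbit of the standard map compared with the uniform rotation at the
frequency of the pendulum. -/
theorem exists_angle_le {h : ℝ} (hh : 1 < h) {K : ℝ} (hK : 0 ≤ K) :
    ∃ C, 0 ≤ C ∧ ∃ μ₀, 0 < μ₀ ∧ μ₀ ≤ 1 ∧ ∀ μ x w, 0 < μ → μ < μ₀ → IsVerletOrbit μ x w →
      0 < w 0 → |pendulumEnergy (x 0) (w 0) - h| ≤ K * μ ^ 2 →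
      ∀ n : ℕ, n * μ ^ 3 ≤ 2 →
        |x n - x 0 - n * (2 * Real.pi * (μ * (pendulumPeriod h)⁻¹))| ≤ C := by
  obtain ⟨K₁, hK₁, μ₀, hμ₀, hμ₀1, hen⟩ := exists_energy_le hh hK
  have hw₀ := sqrt_speed_pos hh
  obtain ⟨C, hC, hstep⟩ := exists_pendulumTime_step hh
    (A := 2 / √(2 * (h - 1)) * K₁) (by positivity)
  obtain ⟨c, hc, hlin⟩ := exists_pendulumTime_linear hh
  have hP := pendulumPeriod_pos hh
  have hpi := Real.two_pi_pos
  -- The periodic part of the time coordinate contributes `c`; the time error is at most `n C μ³ ≤ 2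
  -- C`, converted to an angle.
  refine ⟨c + 2 * Real.pi / pendulumPeriod h * (2 * C), by positivity, μ₀, hμ₀, hμ₀1,
    fun μ x w hμ hμlt hvo hw0 hE0 => ?_⟩
  have hμ1 : μ ≤ 1 := hμlt.le.trans hμ₀1
  have hen' := hen μ x w hμ hμlt hvo hw0 hE0
  have hμ3 : 0 < μ ^ 3 := by positivity
  have htime : ∀ n : ℕ, n * μ ^ 3 ≤ 2 →
      |pendulumTime h (x n) - pendulumTime h (x 0) - n * μ| ≤ n * (C * μ ^ 3) := by
    intro n
    induction n with
    | zero => simp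
    | succ n ih =>
      intro hn
      push_cast at hn ⊢
      have h1 : n * μ ^ 3 ≤ 2 := by linarith
      obtain ⟨hwn, hEn⟩ := hen' n h1
      have h2 := abs_sub_pendulumSpeed_le hh hwn.le hEn
      rw [← mul_assoc] at h2
      have h3 := hstep μ (x n) (w n) hμ hμ1 h2
      rw [← hvo.x_succ] at h3
      have h4 := abs_le.1 h3
      have h5 := abs_le.1 (ih h1)
      rw [abs_le]
      constructor <;> linarith [h4.1, h4.2, h5.1, h5.2]
  intro n hn
  have h1 := hlin (x n) (x 0)
  have h2 : |2 * Real.pi / pendulumPeriod h *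
      (pendulumTime h (x n) - pendulumTime h (x 0) - n * μ)| ≤
      2 * Real.pi / pendulumPeriod h * (2 * C) := by
    rw [abs_mul, abs_of_pos (by positivity : 0 < 2 * Real.pi / pendulumPeriod h)]
    gcongr
    refine (htime n hn).trans ?_
    calc n * (C * μ ^ 3) = n * μ ^ 3 * C := by ring
      _ ≤ 2 * C := by gcongr
  have e : x n - x 0 - n * (2 * Real.pi * (μ * (pendulumPeriod h)⁻¹)) =
      -(2 * Real.pi / pendulumPeriod h * (pendulumTime h (x n) - pendulumTime h (x 0)) -
        (x n - x 0)) + 2 * Real.pi / pendulumPeriod h *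
        (pendulumTime h (x n) - pendulumTime h (x 0) - n * μ) := by
    field_simp
    ring
  rw [e]
  refine (abs_add_le _ _).trans ?_
  rw [abs_neg]
  linarith

end VerletOrbit

/-! ### Comparison of the two slopes -/

section MainTheorem

/-- The half kick added to `z` symmetrizes the step, which is the source of the odd-order
cancellations in the energy. -/
theorem isVerletOrbit_standardMapLift {μ : ℝ} (hμ : 0 < μ) (p : ℝ × ℝ) :
    IsVerletOrbit μ (fun n => ((standardMapLift (μ ^ 2))^[n] p).1) (fun n =>
      ((standardMapLift (μ ^ 2))^[n] p).2 / μ +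
        μ / 2 * Real.sin ((standardMapLift (μ ^ 2))^[n] p).1) := by
  constructor <;> intro n <;> simp only [Function.iterate_succ_apply'] <;>
    generalize (standardMapLift (μ ^ 2))^[n] p = q <;> simp only [standardMapLift] <;>
    field_simp <;> ring

theorem IsPendulumOrbit.neg {X Z : ℝ → ℝ} (h : IsPendulumOrbit X Z) :
    IsPendulumOrbit (fun t => -X t) (fun t => -Z t) := fun t =>
  ⟨(h t).1.fun_neg, by simpa using (h t).2.fun_neg⟩

theorem HasFrequency.of_neg {X : ℝ → ℝ} {ω : ℝ} (h : HasFrequency (fun t => -X t) ω) :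
    HasFrequency X (-ω) := by
  unfold HasFrequency at h ⊢
  have := h.neg
  rw [← mul_neg] at this
  refine this.congr fun t => ?_
  ring

theorem pendulumEnergy_neg (x z : ℝ) : pendulumEnergy (-x) (-z) = pendulumEnergy x z := by
  simp [pendulumEnergy]

/-- Completing the square turns the interpolating energy at `z` into the pendulum energy at the
symmetrized velocity, up to `O(μ²)`. -/
theorem pendulumEnergy_eq_interpolatingEnergy_add (μ x z : ℝ) :
    pendulumEnergy x (z + μ / 2 * Real.sin x) =
      interpolatingEnergy μ x z + μ ^ 2 / 8 * Real.sin x ^ 2 := by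
  simp only [pendulumEnergy, interpolatingEnergy]
  ring

theorem abs_pendulumEnergy_sub_le {μ x z h K : ℝ}
    (hE : |interpolatingEnergy μ x z - h| ≤ K * μ ^ 2) :
    |pendulumEnergy x (z + μ / 2 * Real.sin x) - h| ≤ (|K| + 1) * μ ^ 2 := by
  rw [pendulumEnergy_eq_interpolatingEnergy_add]
  have h1 := Real.sin_sq_le_one x
  have h2 : K * μ ^ 2 ≤ |K| * μ ^ 2 := by gcongr; exact le_abs_self K
  have h3 : μ ^ 2 / 8 * Real.sin x ^ 2 ≤ μ ^ 2 / 8 * 1 := by gcongr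
  have h4 : 0 ≤ μ ^ 2 / 8 * Real.sin x ^ 2 := by positivity
  have h5 := sq_nonneg μ
  rw [abs_le] at hE ⊢
  constructor <;> linarith [hE.1, hE.2]

/-- Above the energy of the saddle, the momentum keeps its sign under the shift by
`(μ / 2) sin x`. -/
theorem mul_add_sin_pos {μ x z h : ℝ} (hμ : 0 < μ) (hμh : μ ^ 2 < h - 1)
    (hE : |pendulumEnergy x (z + μ / 2 * Real.sin x) - h| ≤ (h - 1) / 2) :
    0 < z * (z + μ / 2 * Real.sin x) := by
  set w := z + μ / 2 * Real.sin x with hw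
  have hcos := Real.cos_le_one x
  have hwsq : μ ^ 2 < w ^ 2 := by
    have := (abs_le.1 hE).1
    rw [pendulumEnergy] at this
    linarith
  have hwμ : μ < |w| := by
    rw [sq_lt_sq, abs_of_pos hμ] at hwsq
    exact hwsq
  have hs1 := Real.sin_le_one x
  have hs2 := Real.neg_one_le_sin x
  have hs3 : μ / 2 * Real.sin x ≤ μ / 2 := by nlinarith
  have hs4 : -(μ / 2) ≤ μ / 2 * Real.sin x := by nlinarith
  rcases lt_abs.1 hwμ with h1 | h1
  · exact mul_pos (by linarith) (by linarith)
  · exact mul_pos_of_neg_of_neg (by linarith) (by linarith)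

/-- Two slopes that follow the same sequence up to a bounded error, for a time between `μ⁻³` and
`2 μ⁻³`, agree up to `O(μ³)`. -/
theorem abs_sub_le_of_slopes {μ a b A B : ℝ} {u : ℕ → ℝ} (hμ : 0 < μ) (hμ1 : μ ≤ 1)
    (ha : ∀ n : ℕ, |u n - n * (2 * Real.pi * a)| ≤ A)
    (hb : ∀ n : ℕ, n * μ ^ 3 ≤ 2 → |u n - n * (2 * Real.pi * b)| ≤ B) :
    |a - b| ≤ (A + B) / (2 * Real.pi) * μ ^ 3 := by
  have hμ3 : 0 < μ ^ 3 := by positivity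
  have hμ31 : μ ^ 3 ≤ 1 := pow_le_one₀ hμ.le hμ1
  -- The longest time scale, up to a factor, on which the second bound is available; `N μ³` lies
  -- between 1 and 2 because `μ³ ≤ 1`.
  set N := ⌈(μ ^ 3)⁻¹⌉₊ with hN
  have hN1 : 1 ≤ N * μ ^ 3 := by
    have := mul_le_mul_of_nonneg_right (Nat.le_ceil (μ ^ 3)⁻¹) hμ3.le
    rwa [inv_mul_cancel₀ hμ3.ne'] at this
  have hN2 : N * μ ^ 3 ≤ 2 := by
    have := mul_le_mul_of_nonneg_right (Nat.ceil_lt_add_one (inv_pos.2 hμ3).le).le hμ3.le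
    rw [add_mul, inv_mul_cancel₀ hμ3.ne'] at this
    linarith
  have hab : N * (2 * Real.pi * |a - b|) ≤ A + B := by
    have hd : |(N : ℝ) * (2 * Real.pi * (a - b))| ≤ A + B := by
      have := abs_sub_le (N * (2 * Real.pi * a)) (u N) (N * (2 * Real.pi * b))
      rw [abs_sub_comm _ (u N)] at this
      calc |(N : ℝ) * (2 * Real.pi * (a - b))|
          = |N * (2 * Real.pi * a) - N * (2 * Real.pi * b)| := by ring_nf
        _ ≤ A + B := this.trans (add_le_add (ha N) (hb N hN2))
    rwa [abs_mul, abs_mul, Nat.abs_cast, abs_of_pos Real.two_pi_pos] at hd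
  have hd0 : 0 ≤ 2 * Real.pi * |a - b| := by positivity
  have hpi := Real.two_pi_pos
  rw [div_mul_eq_mul_div, le_div_iff₀ hpi]
  calc |a - b| * (2 * Real.pi) = 1 * (2 * Real.pi * |a - b|) := by ring
    _ ≤ N * μ ^ 3 * (2 * Real.pi * |a - b|) := by gcongr
    _ = N * (2 * Real.pi * |a - b|) * μ ^ 3 := by ring
    _ ≤ (A + B) * μ ^ 3 := by gcongr

theorem mainTheorem5 (h₀ : ℝ) (hh₀ : 1 < h₀) (K : ℝ) :
    ∃ C > (0 : ℝ), ∃ ε₀ > (0 : ℝ), ∀ ε : ℝ, 0 < ε → ε < ε₀ →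
      -- an invariant circle with a point `(x₀, y₀)` of energy `h₀`, up to terms of order `ε`
      ∀ (Γ : Set Cylinder) (x₀ y₀ : ℝ), IsInvariantCircle ε Γ → toCylinder (x₀, y₀) ∈ Γ →
      |interpolatingEnergy (√ε) x₀ (y₀ / √ε) - h₀| ≤ K * ε →
      -- a rotation orbit of the pendulum of energy `h₀` that turns in the same direction
      ∀ X Z : ℝ → ℝ, IsPendulumOrbit X Z → pendulumEnergy (X 0) (Z 0) = h₀ → 0 < Z 0 * y₀ →
      ∃ ωT ωpend : ℝ, HasRotationNumber ε x₀ y₀ ωT ∧ HasFrequency X ωpend ∧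
        |ωT - √ε * ωpend| ≤ C * ε ^ (3 / 2 : ℝ) := by
  obtain ⟨C, hC, μ₀, hμ₀, hμ₀1, hangle⟩ :=
    exists_angle_le hh₀ (by positivity : (0 : ℝ) ≤ |K| + 1)
  have hpi := Real.pi_pos
  have hK : 0 < |K| + 1 := by positivity
  -- One turn from the rotation number plus `C` from the pendulum. The three bounds on ε give `μ <
  -- μ₀` and the two smallness conditions of `mul_add_sin_pos`.
  refine ⟨(2 * Real.pi + C) / (2 * Real.pi), by positivity,
    min (μ₀ ^ 2) (min (h₀ - 1) ((h₀ - 1) / 2 / (|K| + 1))),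
    lt_min (by positivity) (lt_min (by linarith) (div_pos (by linarith) hK)), ?_⟩
  intro ε hε hεlt Γ x₀ y₀ hΓ hmem hE X Z hXZ hEXZ hsign
  obtain ⟨hε1, hε2⟩ := lt_min_iff.1 hεlt
  obtain ⟨hε2, hε3⟩ := lt_min_iff.1 hε2
  obtain ⟨ωT, hωT, hbound⟩ := hΓ.exists_rotationNumber hmem
  set μ := √ε with hμdef
  have hμ : 0 < μ := Real.sqrt_pos.2 hε
  have hμsq : ε = μ ^ 2 := (Real.sq_sqrt hε.le).symm
  have hμ3 : ε ^ (3 / 2 : ℝ) = μ ^ 3 := by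
    rw [hμdef, Real.sqrt_eq_rpow, ← Real.rpow_natCast, ← Real.rpow_mul hε.le]
    norm_num
  rw [hμ3]
  clear_value μ
  subst hμsq
  have hμlt : μ < μ₀ := lt_of_pow_lt_pow_left₀ 2 hμ₀.le hε1
  rw [lt_div_iff₀ hK, mul_comm] at hε3
  have hen := abs_pendulumEnergy_sub_le hE
  have hw := mul_add_sin_pos hμ hε2 (hen.trans hε3.le)
  have horb := isVerletOrbit_standardMapLift hμ (x₀, y₀)
  rcases pos_and_pos_or_neg_and_neg_of_mul_pos hsign with ⟨hZ, hy⟩ | ⟨hZ, hy⟩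
  · refine ⟨ωT, (pendulumPeriod h₀)⁻¹, hωT, hXZ.hasFrequency_of_pos hh₀ hEXZ hZ, ?_⟩
    have hw₀ : 0 < y₀ / μ + μ / 2 * Real.sin x₀ := pos_of_mul_pos_right hw (by positivity)
    exact abs_sub_le_of_slopes hμ (hμlt.le.trans hμ₀1) hbound
      (hangle μ _ _ hμ hμlt horb hw₀ hen)
  -- Rotation in the negative direction is reduced to the positive one by the symmetry `(x, w) ↦
  -- (-x, -w)` of both systems.
  · refine ⟨ωT, -(pendulumPeriod h₀)⁻¹, hωT, (hXZ.neg.hasFrequency_of_pos hh₀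
      ((pendulumEnergy_neg _ _).trans hEXZ) (neg_pos.2 hZ)).of_neg, ?_⟩
    have hw₀ : y₀ / μ + μ / 2 * Real.sin x₀ < 0 :=
      neg_of_mul_pos_right hw (div_neg_of_neg_of_pos hy hμ).le
    refine abs_sub_le_of_slopes hμ (hμlt.le.trans hμ₀1) hbound fun n hn => ?_
    have := hangle μ _ _ hμ hμlt horb.neg (neg_pos.2 hw₀)
      (by rw [pendulumEnergy_neg]; exact hen) n hn
    rw [← abs_neg]
    convert this using 2
    simp only [Function.iterate_zero, id]
    ring

end MainTheorem
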